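/- **Theorem.** Let $\Pi$ be a nonempty finite list (repetitions allowed) of $n$ rankings (complete orders) of a finite candidate set $\mathcal C=\{0,\dots,m-1\}$. For a ranking $\pi$ let $\mathrm{score}_\Pi(\pi)=\sum_{v\in\Pi}d_{KT}(\pi,v)$, where the Kendall–Tau distance $d_{KT}$ is the number of pairs of candidates that two rankings order differently; let $k_{OPT}(\Pi)=\min_\pi \mathrm{score}_\Pi(\pi)$, and let $$d=d(\Pi)=\frac{1}{n(n-1)}\sum_{v\in\Pi}\sum_{w\in\Pi}d_{KT}(v,w)$$ be the average distance ($d=0$ if $n=1$). A ranking $\pi$ respects the unanimity order of $\Pi$ if it places $x$ before $y$ whenever every ranking in $\Pi$ does. For a rational $\lambda\ge1$ let $A(\Pi,\lambda)$ be the set of rankings $\pi$ that respect the unanimity order of $\Pi$ and satisfy $\mathrm{score}_\Pi(\pi)\le\lambda\,k_{OPT}(\Pi)$. *Distinct approximate Kemeny Ranking Aggregation* is the following problem: given $\mathcal C$, $\Pi$, a rational $\lambda\ge1$ and an integer $r\ge0$ (numbers written in binary), output $\ell=\min\{r,|A(\Pi,\lambda)|\}$ pairwise distinct rankings from $A(\Pi,\lambda)$.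 There is an algorithm that solves this problem on every instance $I=(\mathcal C,\Pi,\lambda,r)$ in time $O^*(16^{\lambda d})$, that is, in at most $16^{\lambda d}\cdot p(|I|+\ell)$ steps for a fixed polynomial $p$, where $|I|$ is the size of the encoded input and $\ell\le r$ is the number of rankings output. In particular, the problem is fixed-parameter tractable for the combined parameter $(\lambda,d)$, with time polynomial also in the number of rankings that are output. (Here an algorithm is a program of the WHILE language on binary trees; building a cell, taking a component of a cell, accessing a variable and testing for the empty tree cost one step each.) -/

import Mathlib

/-! ### Rankings and Kemeny scores -/

namespace Kemeny

/-- A ranking (complete order) of the candidates `Fin m`: the bijection sending a candidate `c` to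
its position, i.e. to the number of candidates that are preferred to `c`. So `x` is preferred to
`y` in `π` iff `π x < π y`, and `π.symm i` is the candidate in position `i`. -/
abbrev Ranking (m : ℕ) : Type := Equiv.Perm (Fin m)

/-- Kendall-Tau distance: the number of pairs of candidates that `π` and `σ` order differently.
Each such unordered pair is counted once, as `(x, y)` with `x` before `y` in `π`. -/
def ktDist {m : ℕ} (π σ : Ranking m) : ℕ :=
  (Finset.univ.filter fun p : Fin m × Fin m => π p.1 < π p.2 ∧ σ p.2 < σ p.1).card

/-- Kemeny score of `π` with respect to a (multi)set of votes, given as a list. -/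
def score {m : ℕ} (votes : List (Ranking m)) (π : Ranking m) : ℕ :=
  (votes.map fun v => ktDist π v).sum

/-- The minimum Kemeny score over all rankings. -/
def optScore {m : ℕ} (votes : List (Ranking m)) : ℕ :=
  (Finset.univ : Finset (Ranking m)).inf' Finset.univ_nonempty (score votes)

/-- `π` ranks `x` before `y` whenever all votes do. -/
def RespectsUnanimity {m : ℕ} (votes : List (Ranking m)) (π : Ranking m) : Prop :=
  ∀ x y : Fin m, (∀ v ∈ votes, v x < v y) → π x < π y

/-- Average Kendall-Tau distance: the sum over all ordered pairs of votes divided by `n (n - 1)`,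
where `n` is the number of votes. (For a single vote this is `0 / 0 = 0`.) -/
def avgDist {m : ℕ} (votes : List (Ranking m)) : ℚ :=
  (((votes.map fun v => (votes.map fun w => ktDist v w).sum).sum : ℕ) : ℚ) /
    ((votes.length : ℚ) * ((votes.length : ℚ) - 1))

/-- An instance of Distinct approximate Kemeny Ranking Aggregation. -/
structure Instance where
  /-- number of candidates -/
  m : ℕ
  /-- the votes, repetitions allowed -/
  votes : List (Ranking m)
  votes_ne : votes ≠ []
  /-- approximation factor -/
  lam : ℚ
  one_le_lam : 1 ≤ lam
  /-- number of rankings asked for -/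
  r : ℕ

/-- The rankings that may be output: they respect the unanimity order and have Kemeny score at most
`lam` times the optimum. -/
def Instance.admissible (I : Instance) : Set (Ranking I.m) :=
  {π | RespectsUnanimity I.votes π ∧ (score I.votes π : ℚ) ≤ I.lam * (optScore I.votes : ℚ)}

/-- `out` is a correct output: a list of `min r N` distinct admissible rankings, where `N` is the
number of admissible rankings. -/
def Instance.IsSolution (I : Instance) (out : List (Ranking I.m)) : Prop :=
  out.Nodup ∧ (∀ π ∈ out, π ∈ I.admissible) ∧ out.length = min I.r I.admissible.ncard

/-! ### Machine model

The imperative language WHILE over binary trees, with its usual cost measure: building a cell,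
taking a component of a cell, reading or writing a variable, and testing for `nil` cost one step
each (values are pointers to immutable cells). There is no built-in arithmetic and no
built-in comparison of trees. -/

/-- Binary trees, the only data type. -/
inductive Data where
  | nil : Data
  | cons (a b : Data) : Data

/-- First component (`nil` for `nil`). -/
def Data.hd : Data → Data
  | .nil => .nil
  | .cons a _ => a

/-- Second component (`nil` for `nil`). -/
def Data.tl : Data → Data
  | .nil => .nil
  | .cons _ b => b

/-- Number of nodes. -/
def Data.size : Data → ℕ
  | .nil => 1
  | .cons a b => a.size + b.size + 1

/-- Expressions; variables are numbered. -/
inductive Expr where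
  | var (x : ℕ) : Expr
  | nil : Expr
  | cons (e f : Expr) : Expr
  | hd (e : Expr) : Expr
  | tl (e : Expr) : Expr

/-- The contents of the variables. -/
abbrev Store : Type := ℕ → Data

/-- Value of an expression. -/
def Expr.eval (s : Store) : Expr → Data
  | .var x => s x
  | .nil => Data.nil
  | .cons e f => Data.cons (e.eval s) (f.eval s)
  | .hd e => (e.eval s).hd
  | .tl e => (e.eval s).tl

/-- Time to evaluate an expression: one step for each of its nodes. -/
def Expr.cost : Expr → ℕ
  | .var _ => 1
  | .nil => 1
  | .cons e f => e.cost + f.cost + 1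
  | .hd e => e.cost + 1
  | .tl e => e.cost + 1

/-- Programs. A test succeeds iff the value of its expression is not `nil`. -/
inductive Program where
  | skip : Program
  | assign (x : ℕ) (e : Expr) : Program
  | seq (P Q : Program) : Program
  | cond (e : Expr) (P Q : Program) : Program
  | loop (e : Expr) (P : Program) : Program

/-- `Exec P s s' t`: started in the store `s`, the program `P` halts in the store `s'` after exactly
`t` steps. -/
inductive Exec : Program → Store → Store → ℕ → Prop where
  | skip (s : Store) : Exec .skip s s 1
  | assign (s : Store) (x : ℕ) (e : Expr) :
      Exec (.assign x e) s (Function.update s x (e.eval s)) (e.cost + 1)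
  | seq {P Q : Program} {s s₁ s₂ : Store} {t₁ t₂ : ℕ} :
      Exec P s s₁ t₁ → Exec Q s₁ s₂ t₂ → Exec (.seq P Q) s s₂ (t₁ + t₂)
  | cond_true {e : Expr} {P Q : Program} {s s₁ : Store} {t : ℕ} :
      e.eval s ≠ Data.nil → Exec P s s₁ t → Exec (.cond e P Q) s s₁ (e.cost + 1 + t)
  | cond_false {e : Expr} {P Q : Program} {s s₁ : Store} {t : ℕ} :
      e.eval s = Data.nil → Exec Q s s₁ t → Exec (.cond e P Q) s s₁ (e.cost + 1 + t)
  | loop_done {e : Expr} {P : Program} {s : Store} :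
      e.eval s = Data.nil → Exec (.loop e P) s s (e.cost + 1)
  | loop_step {e : Expr} {P : Program} {s s₁ s₂ : Store} {t₁ t₂ : ℕ} :
      e.eval s ≠ Data.nil → Exec P s s₁ t₁ → Exec (.loop e P) s₁ s₂ t₂ →
        Exec (.loop e P) s s₂ (e.cost + 1 + t₁ + t₂)

/-- On input `x` (in variable `0`, the other variables being `nil`) the program `P` halts after
exactly `t` steps with output `y` (in variable `0`). -/
def Program.Runs (P : Program) (x y : Data) (t : ℕ) : Prop :=
  ∃ s : Store, Exec P (Function.update (fun _ => Data.nil) 0 x) s t ∧ s 0 = y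

/-! ### Encodings -/

/-- A list of trees as a tree. -/
def Data.ofList : List Data → Data
  | [] => .nil
  | a :: l => .cons a (Data.ofList l)

/-- A bit as a tree. -/
def Data.ofBool : Bool → Data
  | false => .nil
  | true => .cons .nil .nil

/-- A natural number in binary, least significant bit first. -/
def Data.ofNat (n : ℕ) : Data := Data.ofList (n.bits.map Data.ofBool)

/-- A ranking, as the list of the candidates from best to worst. -/
def Data.ofRanking {m : ℕ} (π : Ranking m) : Data :=
  Data.ofList (List.ofFn fun i : Fin m => Data.ofNat (π.symm i : ℕ))

/-- A list of rankings. -/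
def Data.ofRankings {m : ℕ} (l : List (Ranking m)) : Data :=
  Data.ofList (l.map Data.ofRanking)

/-- An instance: the number of candidates, the votes, numerator and denominator of the
approximation factor (which is positive), and the number of rankings asked for; all numbers are in
binary. -/
def Instance.encode (I : Instance) : Data :=
  Data.ofList [Data.ofNat I.m, Data.ofRankings I.votes, Data.ofNat I.lam.num.toNat,
    Data.ofNat I.lam.den, Data.ofNat I.r]

end Kemeny

/-! The algorithm builds rankings from the front by dynamic programming. A state consists of the set
of candidates not yet placed and of the cost so far: the disagreements with the votes on pairs with
at least one placed member. The order inside the prefix has no influence on later costs. A state is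
dropped if its cost exceeds λ·score(v) for some vote v. Costs only grow along a ranking and score(v)
≥ k_OPT, so no state on the way to an admissible ranking is lost. One table ignores unanimity and
yields k_OPT, the other enforces unanimity (`isState_of_mem_tableRun`, `mem_tableRun`).

The rankings are then listed from the back. A final segment is kept iff some state of the second
table completes it to an admissible ranking (`extendable_iff`). There are no dead ends, so cutting
each list down to r segments is harmless, and no intermediate list is longer than the output
(`isPartial_grow`, `length_growRun_le`).

There are few states. In a vote v, mark remaining candidates by `true` and placed ones by `false`. A
remaining candidate before a placed one is a disagreement that has already been paid for, so the
inversions of the n marked votes add up to at most the cost of the state. Averaging the pruning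
inequalities over all votes bounds this cost by λ(n-1)d. Hence some vote has at most K = ⌊λd⌋
inversions (`IsState.exists_bitInv_le`). That vote, its bit word and the cost determine the state,
so up to a polynomial factor the states number at most N, the number of bit words of length m with
at most K inversions.

N is subexponential in K. For every fixed 0 < x < 1 the Gaussian binomials at x are bounded by a
constant, whence N ≤ C(m+1)x^(-K) (`bitCount_le`). With x = 16^(-1/k) this gives N^k = O(16^K
(m+1)^k) for every k. So a running time polynomial in |I| + ℓ + N is good enough, whatever its
degree (`exists_polynomial_bitCount`), and the implementation in WHILE may be wasteful. It is
assembled from closure properties of polynomial-time computation, chiefly `PT.foldl`, and ends in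
`PT.solve_ctx`. -/

namespace Kemeny

/-! ### Polynomial bounds -/

theorem polynomial_eval_mono (p : Polynomial ℕ) {a b : ℕ} (h : a ≤ b) : p.eval a ≤ p.eval b := by
  rw [Polynomial.eval_eq_sum, Polynomial.eval_eq_sum]
  exact Finset.sum_le_sum fun i _ => Nat.mul_le_mul_left _ (Nat.pow_le_pow_left h i)

/-- `f` is bounded by a polynomial in `sz`. -/
def PB {ι : Type} (sz f : ι → ℕ) : Prop := ∃ p : Polynomial ℕ, ∀ i, f i ≤ p.eval (sz i)

namespace PB
variable {ι : Type} {sz f g : ι → ℕ}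

theorem mono (hg : PB sz g) (h : ∀ i, f i ≤ g i) : PB sz f := by
  obtain ⟨p, hp⟩ := hg
  exact ⟨p, fun i => (h i).trans (hp i)⟩

theorem add (hf : PB sz f) (hg : PB sz g) : PB sz (fun i => f i + g i) := by
  obtain ⟨p, hp⟩ := hf
  obtain ⟨q, hq⟩ := hg
  exact ⟨p + q, fun i => by simpa using Nat.add_le_add (hp i) (hq i)⟩

theorem mul (hf : PB sz f) (hg : PB sz g) : PB sz (fun i => f i * g i) := by
  obtain ⟨p, hp⟩ := hf
  obtain ⟨q, hq⟩ := hg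
  exact ⟨p * q, fun i => by simpa using Nat.mul_le_mul (hp i) (hq i)⟩

theorem const (c : ℕ) : PB sz (fun _ => c) := ⟨Polynomial.C c, fun i => by simp⟩

theorem id : PB sz sz := ⟨Polynomial.X, fun i => by simp⟩

theorem comp {h : ι → ℕ} (hf : PB sz f) (hh : PB f h) : PB sz h := by
  obtain ⟨p, hp⟩ := hf
  obtain ⟨q, hq⟩ := hh
  exact ⟨q.comp p, fun i => by
    simpa [Polynomial.eval_comp] using (hq i).trans (polynomial_eval_mono q (hp i))⟩

theorem eval (p : Polynomial ℕ) (hf : PB sz f) : PB sz (fun i => p.eval (f i)) :=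
  hf.comp ⟨p, fun _ => le_rfl⟩

theorem reindex {κ : Type} (hf : PB sz f) (r : κ → ι) : PB (fun k => sz (r k)) (fun k => f (r k)) := by
  obtain ⟨p, hp⟩ := hf
  exact ⟨p, fun k => hp (r k)⟩

end PB

/-! ### Encodable types -/

/-- Types whose elements are represented by trees. -/
class Enc (α : Type) where
  /-- the tree that represents an element -/
  enc : α → Data

open Enc

instance : Enc Data := ⟨fun d => d⟩
instance : Enc Unit := ⟨fun _ => Data.nil⟩
instance : Enc Bool := ⟨Data.ofBool⟩
instance : Enc ℕ := ⟨Data.ofNat⟩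
instance {α : Type} [Enc α] : Enc (List α) := ⟨fun l => Data.ofList (l.map enc)⟩
instance {α β : Type} [Enc α] [Enc β] : Enc (α × β) := ⟨fun p => Data.cons (enc p.1) (enc p.2)⟩

/-- Size of the representation. -/
def esize {α : Type} [Enc α] (a : α) : ℕ := (enc a).size

section enc
variable {α β : Type} [Enc α] [Enc β]

@[simp] theorem enc_nil : enc ([] : List α) = Data.nil := rfl
@[simp] theorem enc_cons (a : α) (l : List α) : enc (a :: l) = Data.cons (enc a) (enc l) := rfl
@[simp] theorem enc_pair (a : α) (b : β) : enc (a, b) = Data.cons (enc a) (enc b) := rfl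
@[simp] theorem enc_data (a : Data) : enc a = a := rfl
@[simp] theorem enc_true : enc true = Data.cons Data.nil Data.nil := rfl
@[simp] theorem enc_false : enc false = Data.nil := rfl

theorem enc_nat (n : ℕ) : enc n = enc n.bits := rfl

@[simp] theorem esize_nil : esize ([] : List α) = 1 := rfl
@[simp] theorem esize_cons (a : α) (l : List α) : esize (a :: l) = esize a + esize l + 1 := rfl
@[simp] theorem esize_pair (a : α) (b : β) : esize (a, b) = esize a + esize b + 1 := rfl
theorem esize_mk (p : α × β) : esize p = esize p.1 + esize p.2 + 1 := rfl

theorem esize_pos (a : α) : 0 < esize a := by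
  unfold esize; cases enc a <;> simp [Data.size]

theorem esize_bool_le (b : Bool) : esize b ≤ 3 := by cases b <;> decide

theorem length_le_esize (l : List α) : l.length ≤ esize l := by
  induction l with
  | nil => simp
  | cons a l ih => simp; omega

theorem esize_le_of_mem {a : α} {l : List α} (h : a ∈ l) : esize a ≤ esize l := by
  induction l with
  | nil => simp at h
  | cons b l ih =>
    rcases List.mem_cons.1 h with rfl | h
    · simp; omega
    · have := ih h; simp; omega

theorem esize_append (l l' : List α) : esize (l ++ l') + 1 = esize l + esize l' := by
  induction l with
  | nil => simp; omega
  | cons a l ih => simp; omega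

theorem esize_reverse (l : List α) : esize l.reverse = esize l := by
  induction l with
  | nil => rfl
  | cons a l ih =>
    have := esize_append l.reverse [a]
    simp at this ⊢; omega

theorem esize_sublist {l l' : List α} (h : l.Sublist l') : esize l ≤ esize l' := by
  induction h with
  | slnil => exact le_rfl
  | cons a _ ih => simp; omega
  | cons_cons a _ ih => simp; omega

theorem esize_list_le (l : List α) (M : ℕ) (h : ∀ a ∈ l, esize a ≤ M) :
    esize l ≤ l.length * (M + 1) + 1 := by
  induction l with
  | nil => simp
  | cons a l ih =>
    have h1 := ih fun b hb => h b (List.mem_cons_of_mem _ hb)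
    have h2 := h a List.mem_cons_self
    simp [Nat.succ_mul]; omega

end enc

/-! ### Polynomial-time computability -/

/-- `P b` computes the tree `d'` from the tree `d` in register `b` within `T` steps, without
changing the registers below `b`. -/
def Computes (P : ℕ → Program) (d d' : Data) (T : ℕ) : Prop :=
  ∀ (b : ℕ) (s : Store), s b = d →
    ∃ s' t, Exec (P b) s s' t ∧ s' b = d' ∧ (∀ j < b, s' j = s j) ∧ t ≤ T

/-- `y i` can be computed from `x i`, uniformly in `i`, in time polynomial in `sz i`. -/
def PT {ι α β : Type} [Enc α] [Enc β] (sz : ι → ℕ) (x : ι → α) (y : ι → β) : Prop :=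
  PB sz (fun i => esize (y i)) ∧
    ∃ (P : ℕ → Program) (T : ι → ℕ), PB sz T ∧ ∀ i, Computes P (enc (x i)) (enc (y i)) (T i)

/-- Functions computable in polynomial time. -/
def PF {α β : Type} [Enc α] [Enc β] (f : α → β) : Prop := PT esize (fun a => a) f

variable {ι α β γ δ σ ε : Type} [Enc α] [Enc β] [Enc γ] [Enc δ] [Enc σ] [Enc ε]
  {sz : ι → ℕ} {x : ι → α}

/-- Programs see only trees. A result can therefore be rewritten, or reread as an element of another
type, at no cost. -/
theorem PT.of_enc_eq {y : ι → β} {z : ι → γ} (h : PT sz x y) (e : ∀ i, enc (y i) = enc (z i)) :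
    PT sz x z := by
  obtain ⟨h1, P, T, hT, h2⟩ := h
  exact ⟨h1.mono fun i => by simp [esize, e], P, T, hT, fun i => e i ▸ h2 i⟩

theorem PT.trans {y : ι → β} {z : ι → γ} (h : PT sz x y) (h' : PT sz y z) : PT sz x z := by
  obtain ⟨_, P, T, hT, h2⟩ := h
  obtain ⟨h1, Q, T', hT', h3⟩ := h'
  refine ⟨h1, fun b => .seq (P b) (Q b), _, hT.add hT', fun i b s hs => ?_⟩
  obtain ⟨s₁, t₁, e₁, v₁, k₁, b₁⟩ := h2 i b s hs
  obtain ⟨s₂, t₂, e₂, v₂, k₂, b₂⟩ := h3 i b s₁ v₁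
  exact ⟨s₂, _, .seq e₁ e₂, v₂, fun j hj => (k₂ j hj).trans (k₁ j hj), Nat.add_le_add b₁ b₂⟩

/-- A polynomial in the size of `y i` becomes one in `sz i` as soon as that size is bounded. This is
why `PT` includes a bound on the size of the result. -/
theorem PF.toPT {f : β → γ} (hf : PF f) {y : ι → β} (hy : PB sz fun i => esize (y i)) :
    PT sz y fun i => f (y i) := by
  obtain ⟨h1, P, T, hT, h2⟩ := hf
  exact ⟨hy.comp (h1.reindex y |> fun ⟨p, hp⟩ => ⟨p, hp⟩), P, fun i => T (y i),
    hy.comp (hT.reindex y), fun i => h2 (y i)⟩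

theorem PT.comp {f : β → γ} {y : ι → β} (h : PT sz x y) (hf : PF f) :
    PT sz x fun i => f (y i) := h.trans (hf.toPT h.1)

theorem PF.comp {f : β → γ} {g : α → β} (hf : PF f) (hg : PF g) : PF fun a => f (g a) :=
  PT.comp hg hf

theorem PF.id : PF (fun a : α => a) :=
  ⟨PB.id, fun _ => .skip, fun _ => 1, PB.const 1, fun _ _ s hs => ⟨s, 1, .skip s, hs, fun _ _ => rfl, le_rfl⟩⟩

theorem PT.const (c : β) : PT sz x fun _ => c := by
  have hE : ∀ d : Data, ∃ e : Expr, ∀ s, e.eval s = d := fun d => by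
    induction d with
    | nil => exact ⟨.nil, fun _ => rfl⟩
    | cons a b iha ihb =>
      obtain ⟨e, he⟩ := iha
      obtain ⟨f, hf⟩ := ihb
      exact ⟨.cons e f, fun s => by simp [Expr.eval, he, hf]⟩
  obtain ⟨e, he⟩ := hE (enc c)
  refine ⟨PB.const _, fun b => .assign b e, fun _ => e.cost + 1, PB.const _, fun i b s hs => ?_⟩
  exact ⟨_, _, .assign s b e, by simp [he], fun j hj => by simp [hj.ne], le_rfl⟩

theorem PF.const (c : β) : PF fun _ : α => c := PT.const c

theorem Data.hd_size_le (d : Data) : d.hd.size ≤ d.size := by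
  cases d <;> simp [Data.hd, Data.size]; omega

theorem Data.tl_size_le (d : Data) : d.tl.size ≤ d.size := by
  cases d <;> simp [Data.tl, Data.size]; omega

theorem PF.of_hd {f : α → β} (h : ∀ a, enc (f a) = (enc a).hd) : PF f :=
  ⟨PB.id.mono fun a => by simpa [esize, h] using Data.hd_size_le _,
    fun b => .assign b (.hd (.var b)), fun _ => 3, PB.const 3, fun i b s hs =>
    ⟨_, _, .assign s b _, by simp [Expr.eval, h, hs], fun j hj => by simp [hj.ne], le_rfl⟩⟩

theorem PF.of_tl {f : α → β} (h : ∀ a, enc (f a) = (enc a).tl) : PF f :=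
  ⟨PB.id.mono fun a => by simpa [esize, h] using Data.tl_size_le _,
    fun b => .assign b (.tl (.var b)), fun _ => 3, PB.const 3, fun i b s hs =>
    ⟨_, _, .assign s b _, by simp [Expr.eval, h, hs], fun j hj => by simp [hj.ne], le_rfl⟩⟩

theorem PF.fst : PF (Prod.fst : α × β → α) := PF.of_hd fun _ => rfl
theorem PF.snd : PF (Prod.snd : α × β → β) := PF.of_tl fun _ => rfl

/-- The second program is relocated to start at register `b+2`, so it leaves the input in `b` and
the first result in `b+1` intact. Registers above the base may hold anything, so no clean-up is
needed. -/
theorem PT.pair {y : ι → β} {z : ι → γ} (hy : PT sz x y) (hz : PT sz x z) :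
    PT sz x fun i => (y i, z i) := by
  obtain ⟨hy1, P, T, hT, hP⟩ := hy
  obtain ⟨hz1, Q, U, hU, hQ⟩ := hz
  refine ⟨by simpa using (hy1.add hz1).add (PB.const 1),
    fun b => .seq (.seq (.assign (b+1) (.var b)) (P (b+1)))
      (.seq (.seq (.assign (b+2) (.var b)) (Q (b+2)))
        (.assign b (.cons (.var (b+1)) (.var (b+2))))),
    _, ((hT.add hU).add (PB.const 8)), fun i b s hs => ?_⟩
  obtain ⟨s₁, t₁, e₁, v₁, k₁, b₁⟩ := hP i (b+1) (Function.update s (b+1) (s b)) (by simp [hs])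
  have hb : s₁ b = s b := by simpa using k₁ b (by omega)
  obtain ⟨s₂, t₂, e₂, v₂, k₂, b₂⟩ := hQ i (b+2) (Function.update s₁ (b+2) (s₁ b)) (by simp [hb, hs])
  have h1 : s₂ (b+1) = enc (y i) := by simpa [v₁] using k₂ (b+1) (by omega)
  refine ⟨_, _, .seq (.seq (.assign s (b+1) (.var b)) e₁)
    (.seq (.seq (.assign s₁ (b+2) (.var b)) e₂) (.assign s₂ b _)), ?_, ?_, ?_⟩
  · simp [Expr.eval, h1, v₂]
  · intro j hj
    have a1 := k₁ j (by omega)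
    have a2 := k₂ j (by omega)
    rw [Function.update_of_ne (by omega)] at a1 a2 ⊢
    rw [a2, a1]
  · simp [Expr.cost]; omega

theorem PF.pair {f : α → β} {g : α → γ} (hf : PF f) (hg : PF g) : PF fun a => (f a, g a) :=
  PT.pair hf hg

theorem PF.of_cons {f : α → δ} {g : α → β} {h : α → γ} (hg : PF g) (hh : PF h)
    (e : ∀ a, enc (f a) = Data.cons (enc (g a)) (enc (h a))) : PF f :=
  PT.of_enc_eq (PT.pair hg hh) fun a => (e a).symm

theorem PF.cons {f : α → β} {g : α → List β} (hf : PF f) (hg : PF g) : PF fun a => f a :: g a :=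
  PF.of_cons hf hg fun _ => rfl

/-- Case distinction on whether a tree is `nil`. -/
theorem PF.ite_enc {f : α → β} {c : α → δ} {g : α → γ} {h : α → σ} (hc : PF c) (hg : PF g) (hh : PF h)
    (e1 : ∀ a, enc (c a) ≠ Data.nil → enc (f a) = enc (g a))
    (e2 : ∀ a, enc (c a) = Data.nil → enc (f a) = enc (h a)) : PF f := by
  obtain ⟨-, R, V, hV, hR⟩ := hc
  obtain ⟨hg1, P, T, hT, hP⟩ := hg
  obtain ⟨hh1, Q, U, hU, hQ⟩ := hh
  refine ⟨(hg1.add hh1).mono fun a => ?_, fun b => .seq (.seq (.assign (b+1) (.var b)) (R (b+1)))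
    (.cond (.var (b+1)) (P b) (Q b)), _, ((hV.add hT).add hU).add (PB.const 4), fun a b s hs => ?_⟩
  · by_cases h : enc (c a) = Data.nil
    · simp [esize, e2 a h]
    · simp [esize, e1 a h]
  obtain ⟨s₁, t₁, x₁, v₁, k₁, b₁⟩ := hR a (b+1) (Function.update s (b+1) (s b)) (by simp [hs])
  have hb : s₁ b = enc a := by simpa [hs] using k₁ b (by omega)
  have hk : ∀ j < b, s₁ j = s j := fun j hj => by
    have := k₁ j (by omega)
    rwa [Function.update_of_ne (by omega)] at this
  have run := Exec.seq (.assign s (b+1) (.var b)) x₁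
  by_cases h : enc (c a) = Data.nil
  · obtain ⟨s₂, t₂, x₂, v₂, k₂, b₂⟩ := hQ a b s₁ hb
    exact ⟨s₂, _, .seq run (.cond_false (by simp [Expr.eval, v₁, h]) x₂), by rw [v₂, e2 a h],
      fun j hj => (k₂ j hj).trans (hk j hj), by simp [Expr.cost]; omega⟩
  · obtain ⟨s₂, t₂, x₂, v₂, k₂, b₂⟩ := hP a b s₁ hb
    exact ⟨s₂, _, .seq run (.cond_true (by simp [Expr.eval, v₁, h]) x₂), by rw [v₂, e1 a h],
      fun j hj => (k₂ j hj).trans (hk j hj), by simp [Expr.cost]; omega⟩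

theorem PF.cond {c : α → Bool} {g h : α → β} (hc : PF c) (hg : PF g) (hh : PF h) :
    PF fun a => bif c a then g a else h a :=
  PF.ite_enc hc hg hh (fun a ha => by cases e : c a <;> simp_all)
    (fun a ha => by cases e : c a <;> simp_all)

/-- The program of a loop over the list in register `b + 1`, with state in register `b + 2`. -/
def foldlLoop (P : ℕ → Program) (b : ℕ) : Program :=
  .loop (.var (b+1)) (.seq (.assign (b+3) (.cons (.var b) (.cons (.var (b+2)) (.hd (.var (b+1))))))
    (.seq (P (b+3)) (.seq (.assign (b+2) (.var (b+3))) (.assign (b+1) (.tl (.var (b+1)))))))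

/-- The bound `K` is required only for the states that the loop really reaches; the summand 20
covers the test and the copying of one round. -/
theorem exec_foldlLoop {f : γ → σ → ε → σ} {P : ℕ → Program} {T : γ × σ × ε → ℕ}
    (hP : ∀ q : γ × σ × ε, Computes P (enc q) (enc (f q.1 q.2.1 q.2.2)) (T q)) (c : γ) (K b : ℕ)
    (l : List ε) (s0 : σ)
    (hK : ∀ l' e, (l' ++ [e]) <+: l → T (c, l'.foldl (f c) s0, e) ≤ K) (s : Store)
    (h0 : s b = enc c) (h1 : s (b+1) = enc l) (h2 : s (b+2) = enc s0) :
    ∃ s' t, Exec (foldlLoop P b) s s' t ∧ s' (b+2) = enc (l.foldl (f c) s0) ∧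
      (∀ j < b, s' j = s j) ∧ t ≤ l.length * (K + 20) + 2 := by
  induction l generalizing s0 s with
  | nil => exact ⟨s, _, .loop_done (by simpa [Expr.eval] using h1), h2, fun _ _ => rfl, by simp [Expr.cost]⟩
  | cons e l ih =>
    obtain ⟨s₁, t₁, x₁, v₁, k₁, b₁⟩ := hP (c, s0, e) (b+3)
      (Function.update s (b+3) (Expr.eval s (.cons (.var b) (.cons (.var (b+2)) (.hd (.var (b+1)))))))
      (by simp [Expr.eval, h0, h1, h2, Data.hd])
    have hk : ∀ j < b + 3, s₁ j = s j := fun j hj => by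
      have := k₁ j hj
      rwa [Function.update_of_ne (by omega)] at this
    set s₂ := Function.update s₁ (b+2) (Expr.eval s₁ (.var (b+3))) with hs₂
    set s₃ := Function.update s₂ (b+1) (Expr.eval s₂ (.tl (.var (b+1)))) with hs₃
    have hk3 : ∀ j < b + 1, s₃ j = s j := fun j hj => by
      rw [hs₃, Function.update_of_ne (by omega), hs₂, Function.update_of_ne (by omega)]
      exact hk j (by omega)
    obtain ⟨s', t, x, v, k, hb⟩ := ih (f c s0 e)
      (fun l' e' h => hK (e :: l') e' (by simpa using h)) s₃ (by rw [hk3 b (by omega), h0])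
      (by simp [hs₃, hs₂, Expr.eval, hk (b+1) (by omega), h1, Data.tl])
      (by simp [hs₃, hs₂, Expr.eval, v₁])
    refine ⟨s', _, .loop_step (by simp [Expr.eval, h1]) (.seq (.assign _ _ _) (.seq x₁ (.seq (.assign _ _ _)
      (.assign _ _ _)))) x, v, fun j hj => (k j hj).trans (hk3 j (by omega)), ?_⟩
    have := hK [] e (by simp)
    simp only [List.foldl_nil] at this
    simp [Expr.cost, Nat.succ_mul]; omega

/-- Iterating a polynomial-time step may blow up the state exponentially. The hypothesis `hb` on all
intermediate states excludes this, and each round then costs a polynomial in the same quantities. -/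
theorem PT.foldl {c : ι → γ} {s0 : ι → σ} {L : ι → List ε} {f : γ → σ → ε → σ} {B : ι → ℕ}
    (hc : PT sz x c) (hs : PT sz x s0) (hL : PT sz x L)
    (hf : PF fun q : γ × σ × ε => f q.1 q.2.1 q.2.2) (hB : PB sz B)
    (hb : ∀ i l', l' <+: L i → esize (l'.foldl (f (c i)) (s0 i)) ≤ B i) :
    PT sz x fun i => (L i).foldl (f (c i)) (s0 i) := by
  refine (hc.pair (hs.pair hL)).trans ?_
  obtain ⟨-, P, T, ⟨p, hp⟩, hP⟩ := hf
  refine ⟨hB.mono fun i => hb i _ List.prefix_rfl,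
    fun b => .seq (.assign (b+1) (.tl (.tl (.var b)))) (.seq (.assign (b+2) (.hd (.tl (.var b))))
      (.seq (.assign b (.hd (.var b))) (.seq (foldlLoop P b) (.assign b (.var (b+2)))))),
    fun i => esize (L i) * (p.eval (esize (c i) + (B i + esize (L i) + 1) + 1) + 20) + 20,
    ((hL.1.mul (((hc.1.add ((hB.add hL.1).add (PB.const 1))).add (PB.const 1)).eval p
      |>.add (PB.const 20))).add (PB.const 20)), fun i b s h => ?_⟩
  set s₁ := Function.update s (b+1) (enc (L i)) with hs₁
  set s₂ := Function.update s₁ (b+2) (enc (s0 i)) with hs₂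
  set s₃ := Function.update s₂ b (enc (c i)) with hs₃
  have x₁ : Exec (.assign (b+1) (.tl (.tl (.var b)))) s s₁ 4 := by
    have := Exec.assign s (b+1) (.tl (.tl (.var b)))
    simpa [Expr.eval, h, Data.tl, Expr.cost] using this
  have x₂ : Exec (.assign (b+2) (.hd (.tl (.var b)))) s₁ s₂ 4 := by
    have := Exec.assign s₁ (b+2) (.hd (.tl (.var b)))
    simpa [Expr.eval, h, Data.tl, Data.hd, Expr.cost, hs₁] using this
  have x₃ : Exec (.assign b (.hd (.var b))) s₂ s₃ 3 := by
    have := Exec.assign s₂ b (.hd (.var b))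
    simpa [Expr.eval, h, Data.tl, Data.hd, Expr.cost, hs₁, hs₂] using this
  obtain ⟨s', t, x, v, k, hb'⟩ := exec_foldlLoop hP (c i)
    (p.eval (esize (c i) + (B i + esize (L i) + 1) + 1)) b (L i) (s0 i) (fun l' e hl => by
      refine (hp _).trans (polynomial_eval_mono p ?_)
      have h1 := hb i l' ((List.prefix_append _ _).trans hl)
      have h2 : esize e ≤ esize (L i) := esize_le_of_mem (hl.subset (by simp))
      simp; omega) s₃ (by simp [hs₃]) (by simp [hs₃, hs₂, hs₁]) (by simp [hs₃, hs₂])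
  refine ⟨_, _, .seq x₁ (.seq x₂ (.seq x₃ (.seq x (.assign _ _ _)))), by simp [Expr.eval, v], ?_, ?_⟩
  · intro j hj
    rw [Function.update_of_ne (by omega), k j hj, hs₃, Function.update_of_ne (by omega), hs₂,
      Function.update_of_ne (by omega), hs₁, Function.update_of_ne (by omega)]
  · have := Nat.mul_le_mul_right (p.eval (esize (c i) + (B i + esize (L i) + 1) + 1) + 20)
      (length_le_esize (L i))
    simp only [Expr.cost]; omega

end Kemeny

namespace Kemeny
open Enc
variable {ι α β γ δ σ ε : Type} [Enc α] [Enc β] [Enc γ] [Enc δ] [Enc σ] [Enc ε]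
  {sz : ι → ℕ} {x : ι → α}

/-! ### Lists -/

theorem PF.foldl {s0 : α → σ} {L : α → List ε} {f : α → σ → ε → σ} {B : α → ℕ}
    (hL : PF L) (hs : PF s0) (hf : PF fun q : α × σ × ε => f q.1 q.2.1 q.2.2)
    (hB : PB esize B) (hb : ∀ a l', l' <+: L a → esize (l'.foldl (f a) (s0 a)) ≤ B a) :
    PF fun a => (L a).foldl (f a) (s0 a) :=
  PT.foldl PF.id hs hL hf hB hb

theorem PF.reverse : PF (List.reverse : List α → List α) := by
  have h : PF fun l : List α => l.foldl (fun s e => e :: s) [] := by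
    refine PF.foldl (f := fun _ s e => e :: s) (B := esize) PF.id (PF.const [])
      (PF.cons (PF.snd.comp PF.snd) (PF.fst.comp PF.snd)) PB.id fun a l' hl => ?_
    rw [List.foldl_flip_cons_eq_append', List.append_nil, esize_reverse]
    exact esize_sublist hl.sublist
  exact PT.of_enc_eq h fun l => by rw [List.foldl_flip_cons_eq_append', List.append_nil]

theorem PF.foldr {s0 : α → σ} {L : α → List ε} {f : α → ε → σ → σ} {B : α → ℕ}
    (hL : PF L) (hs : PF s0) (hf : PF fun q : α × ε × σ => f q.1 q.2.1 q.2.2)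
    (hB : PB esize B) (hb : ∀ a l', l' <:+ L a → esize (l'.foldr (f a) (s0 a)) ≤ B a) :
    PF fun a => (L a).foldr (f a) (s0 a) := by
  have h : PF fun a => (L a).reverse.foldl (fun s e => f a e s) (s0 a) :=
    PF.foldl (f := fun a s e => f a e s) (PF.reverse.comp hL) hs
      (hf.comp (PF.fst.pair ((PF.snd.comp PF.snd).pair (PF.fst.comp PF.snd)))) hB
      fun a l' hl => by
        have := hb a l'.reverse (List.reverse_prefix.1 (by simpa using hl))
        rwa [List.foldr_reverse] at this
  simpa only [List.foldl_reverse] using h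

theorem PF.append {f g : α → List β} (hf : PF f) (hg : PF g) : PF fun a => f a ++ g a := by
  have h : PF fun a => (f a).foldr (fun e s => e :: s) (g a) := by
    refine PF.foldr (f := fun _ e s => e :: s) hf hg
      (PF.cons (PF.fst.comp PF.snd) (PF.snd.comp PF.snd)) (hf.1.add hg.1) fun a l' hl => ?_
    have h1 := esize_append l' (g a)
    have h2 := esize_sublist hl.sublist
    rw [List.foldr_cons_eq_append]
    simp only [List.map_id']
    omega
  exact PT.of_enc_eq h fun l => by simp

theorem esize_flatMap_le {ε : Type} (g : ε → List β) (l : List ε) (M : ℕ) (h : ∀ e ∈ l, esize (g e) ≤ M) :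
    esize (l.flatMap g) ≤ l.length * M + 1 := by
  induction l with
  | nil => simp
  | cons e l ih =>
    have h1 := ih fun b hb => h b (List.mem_cons_of_mem _ hb)
    have h2 := h e List.mem_cons_self
    have h3 := esize_append (g e) (l.flatMap g)
    simp [Nat.succ_mul]; omega

theorem foldr_append_eq_flatMap {ε β : Type} (g : ε → List β) (l : List ε) :
    l.foldr (fun e s => g e ++ s) [] = l.flatMap g := by
  induction l <;> simp_all

theorem PF.flatMap {L : α → List ε} {g : α → ε → List β} (hL : PF L)
    (hg : PF fun q : α × ε => g q.1 q.2) : PF fun a => (L a).flatMap (g a) := by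
  obtain ⟨p, hp⟩ := hg.1
  have h : PF fun a => (L a).foldr (fun e s => g a e ++ s) [] := by
    refine PF.foldr (f := fun a e s => g a e ++ s)
      (B := fun a => esize (L a) * p.eval (esize a + esize (L a) + 1) + 1) hL (PF.const [])
      (PF.append (hg.comp (PF.fst.pair (PF.fst.comp PF.snd))) (PF.snd.comp PF.snd))
      ((hL.1.mul (((PB.id.add hL.1).add (PB.const 1)).eval p)).add (PB.const 1)) fun a l' hl => ?_
    rw [foldr_append_eq_flatMap]
    refine (esize_flatMap_le (g a) l' (p.eval (esize a + esize (L a) + 1)) fun e he => ?_).trans ?_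
    · refine (hp (a, e)).trans (polynomial_eval_mono p ?_)
      have := esize_le_of_mem (hl.subset he)
      simp; omega
    · have := (hl.length_le).trans (length_le_esize (L a))
      exact Nat.add_le_add_right (Nat.mul_le_mul_right _ this) 1
  exact PT.of_enc_eq h fun l => by rw [foldr_append_eq_flatMap]

theorem PF.map {L : α → List ε} {g : α → ε → β} (hL : PF L)
    (hg : PF fun q : α × ε => g q.1 q.2) : PF fun a => (L a).map (g a) := by
  have h := PF.flatMap (g := fun a e => [g a e]) hL (PF.cons hg (PF.const []))
  exact PT.of_enc_eq h fun a => by rw [List.map_eq_flatMap]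

theorem PF.filter {L : α → List ε} {g : α → ε → Bool} (hL : PF L)
    (hg : PF fun q : α × ε => g q.1 q.2) : PF fun a => (L a).filter (g a) := by
  have h := PF.flatMap (g := fun a e => bif g a e then [e] else []) hL
    (PF.cond hg (PF.cons PF.snd (PF.const [])) (PF.const []))
  refine PT.of_enc_eq h fun a => ?_
  congr 1
  induction L a with
  | nil => rfl
  | cons e l ih => cases h : g a e <;> simp [h, ih]

theorem PF.and {f g : α → Bool} (hf : PF f) (hg : PF g) : PF fun a => f a && g a :=
  PT.of_enc_eq (PF.cond hf hg (PF.const false)) fun a => by cases h : f a <;> simp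

theorem PF.or {f g : α → Bool} (hf : PF f) (hg : PF g) : PF fun a => f a || g a :=
  PT.of_enc_eq (PF.cond hf (PF.const true) hg) fun a => by cases h : f a <;> simp

theorem PF.not {f : α → Bool} (hf : PF f) : PF fun a => !f a :=
  PT.of_enc_eq (PF.cond hf (PF.const false) (PF.const true)) fun a => by cases h : f a <;> simp

theorem PF.xor {f g : α → Bool} (hf : PF f) (hg : PF g) : PF fun a => Bool.xor (f a) (g a) :=
  PT.of_enc_eq (PF.cond hf hg.not hg) fun a => by cases h : f a <;> simp

theorem PF.any {L : α → List ε} {g : α → ε → Bool} (hL : PF L)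
    (hg : PF fun q : α × ε => g q.1 q.2) : PF fun a => (L a).any (g a) := by
  have h : PF fun a => (L a).foldr (fun e s => g a e || s) false :=
    PF.foldr (f := fun a e s => g a e || s) hL (PF.const false)
      (PF.or (hg.comp (PF.fst.pair (PF.fst.comp PF.snd))) (PF.snd.comp PF.snd))
      (PB.const 3) fun a l' _ => esize_bool_le _
  exact PT.of_enc_eq h fun a => by congr 1; induction L a <;> simp_all

theorem PF.all {L : α → List ε} {g : α → ε → Bool} (hL : PF L)
    (hg : PF fun q : α × ε => g q.1 q.2) : PF fun a => (L a).all (g a) :=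
  PT.of_enc_eq (PF.any (g := fun a e => !g a e) hL hg.not).not fun a => by
    congr 1; induction L a <;> simp_all

theorem PF.isNil : PF (List.isEmpty : List α → Bool) :=
  PF.ite_enc PF.id (PF.const false) (PF.const true)
    (fun a h => by cases a <;> simp_all) (fun a h => by cases a <;> simp_all)

theorem PF.tail : PF (List.tail : List α → List α) :=
  PF.of_tl fun a => by cases a <;> rfl

/-- The first component of a nonempty list, with a default value that is coded `nil`. -/
theorem PF.head (d : α) (hd : enc d = Data.nil) : PF (fun l : List α => l.headD d) :=
  PF.of_hd fun a => by cases a <;> simp [Data.hd, hd]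

/-! ### Binary arithmetic -/

theorem esize_bits (l : List Bool) : 2 * l.length + 1 ≤ esize l ∧ esize l ≤ 4 * l.length + 1 := by
  induction l with
  | nil => simp
  | cons b l ih =>
    have h1 := esize_bool_le b
    have h2 := esize_pos b
    simp; omega

theorem size_bounds (n : ℕ) : 2 * n.size + 1 ≤ esize n ∧ esize n ≤ 4 * n.size + 1 := by
  have := esize_bits n.bits
  rwa [Nat.size_eq_bits_len] at *

theorem size_add_le (a b : ℕ) : (a + b).size ≤ a.size + b.size + 1 := by
  rw [Nat.size_le]
  have h1 := Nat.lt_size_self a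
  have h2 := Nat.lt_size_self b
  have h3 : 2 ^ a.size ≤ 2 ^ (a.size + b.size) := Nat.pow_le_pow_right (by norm_num) (by omega)
  have h4 : 2 ^ b.size ≤ 2 ^ (a.size + b.size) := Nat.pow_le_pow_right (by norm_num) (by omega)
  rw [pow_succ]; omega

/-- The size is not monotone, because a digit 1 takes four nodes and a digit 0 only two; the factor
2 makes up for that. -/
theorem esize_nat_mono {a b : ℕ} (h : a ≤ b) : esize a ≤ 2 * esize b := by
  have h1 := size_bounds a
  have h2 := size_bounds b
  have h4 := Nat.size_le_size h
  omega

theorem esize_nat_le (a : ℕ) : esize a ≤ 4 * a + 1 := by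
  have h1 := size_bounds a
  have h4 : a.size ≤ a := Nat.size_le.2 Nat.lt_two_pow_self
  omega

theorem bits_bit_cases (n : ℕ) : n = 0 ∨ ∃ b k, (k = 0 → b = true) ∧ n = Nat.bit b k ∧ n.bits = b :: k.bits := by
  induction n using Nat.binaryRec' with
  | zero => exact .inl rfl
  | bit b k h _ => exact .inr ⟨b, k, h, rfl, Nat.bits_append_bit k b h⟩

theorem PF.div2 : PF Nat.div2 := PF.of_tl fun n => by
  rcases bits_bit_cases n with rfl | ⟨b, k, -, rfl, h⟩
  · rfl
  · rw [enc_nat (Nat.bit b k), h, Nat.div2_bit]; rfl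

theorem PF.bodd : PF Nat.bodd := PF.of_hd fun n => by
  rcases bits_bit_cases n with rfl | ⟨b, k, -, rfl, h⟩
  · rfl
  · rw [enc_nat (Nat.bit b k), h, Nat.bodd_bit]; rfl

theorem enc_nat_eq_nil {n : ℕ} : enc n = Data.nil ↔ n = 0 := by
  rcases bits_bit_cases n with rfl | ⟨b, k, h0, rfl, h⟩
  · simp [enc_nat]
  · rw [enc_nat, h]
    cases b <;> simp_all [Nat.bit]

theorem PF.bits : PF Nat.bits := PT.of_enc_eq PF.id fun _ => rfl

/-- Prepending the digit to the numeral is right unless the numeral is empty: the digit 0 in front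
of zero must give the empty numeral again. -/
theorem PF.bit : PF fun q : Bool × ℕ => Nat.bit q.1 q.2 := by
  have h0 : PF fun q : Bool × ℕ => bif q.1 then [true] else [] :=
    PF.cond PF.fst (PF.const _) (PF.const _)
  have h1 : PF fun q : Bool × ℕ => q.1 :: q.2.bits := PF.cons PF.fst (PF.bits.comp PF.snd)
  refine PF.ite_enc (f := fun q : Bool × ℕ => Nat.bit q.1 q.2) PF.snd h1 h0 (fun q h => ?_) fun q h => ?_
  · rw [enc_nat, Nat.bits_append_bit q.2 q.1 fun h' => absurd (enc_nat_eq_nil.2 h') h]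
  · obtain ⟨b, n⟩ := q
    obtain rfl : n = 0 := enc_nat_eq_nil.1 h
    cases b <;> simp [enc_nat]

end Kemeny

/-! ### Addition, comparison and multiplication of binary numerals. -/

namespace Kemeny
open Enc
variable {ι α β γ δ σ ε : Type} [Enc α] [Enc β] [Enc γ] [Enc δ] [Enc σ] [Enc ε]

/-- Addition with carry, one digit; the digits of the sum are collected in the last component. -/
def addStep (q : ℕ × ℕ × Bool × List Bool) : ℕ × ℕ × Bool × List Bool :=
  (q.1.div2, q.2.1.div2, bif q.1.bodd then q.2.1.bodd || q.2.2.1 else q.2.1.bodd && q.2.2.1,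
    Bool.xor q.1.bodd (Bool.xor q.2.1.bodd q.2.2.1) :: q.2.2.2)

theorem PF.addStep : PF addStep := by
  have h1 : PF fun q : ℕ × ℕ × Bool × List Bool => q.1 := PF.fst
  have h2 : PF fun q : ℕ × ℕ × Bool × List Bool => q.2.1 := PF.fst.comp PF.snd
  have h3 : PF fun q : ℕ × ℕ × Bool × List Bool => q.2.2.1 := PF.fst.comp (PF.snd.comp PF.snd)
  have h4 : PF fun q : ℕ × ℕ × Bool × List Bool => q.2.2.2 := PF.snd.comp (PF.snd.comp PF.snd)
  have a := PF.bodd.comp h1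
  have b := PF.bodd.comp h2
  exact (PF.div2.comp h1).pair ((PF.div2.comp h2).pair
    ((PF.cond a (b.or h3) (b.and h3)).pair ((a.xor (b.xor h3)).cons h4)))

theorem addStep_value (q : ℕ × ℕ × Bool × List Bool) :
    q.1 + q.2.1 + q.2.2.1.toNat = Nat.bit (Bool.xor q.1.bodd (Bool.xor q.2.1.bodd q.2.2.1))
      ((addStep q).1 + (addStep q).2.1 + (addStep q).2.2.1.toNat) := by
  have h1 := Nat.bodd_add_div2 q.1
  have h2 := Nat.bodd_add_div2 q.2.1
  simp only [addStep, Nat.bit_val]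
  revert h1 h2
  cases q.1.bodd <;> cases q.2.1.bodd <;> cases q.2.2.1 <;> simp <;> omega

/-- The run of the adder on a list that only serves as a clock. -/
def addRun (l : List Bool) (q : ℕ × ℕ × Bool × List Bool) : ℕ × ℕ × Bool × List Bool :=
  l.foldl (fun q _ => addStep q) q

/-- The invariant is the number whose low digits are those collected so far and whose high part is
the sum of what is left of both summands and the carry. -/
theorem addRun_spec (l : List Bool) (q : ℕ × ℕ × Bool × List Bool) :
    (addRun l q).2.2.2.foldl (fun n d => Nat.bit d n)
        ((addRun l q).1 + (addRun l q).2.1 + (addRun l q).2.2.1.toNat) =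
      q.2.2.2.foldl (fun n d => Nat.bit d n) (q.1 + q.2.1 + q.2.2.1.toNat) ∧
    (addRun l q).1 = q.1 / 2 ^ l.length ∧ (addRun l q).2.1 = q.2.1 / 2 ^ l.length ∧
    (addRun l q).2.2.2.length = l.length + q.2.2.2.length := by
  induction l generalizing q with
  | nil => simp [addRun]
  | cons e l ih =>
    obtain ⟨h1, h2, h3, h4⟩ := ih (addStep q)
    have e1 : addRun (e :: l) q = addRun l (addStep q) := rfl
    rw [e1, h1, h2, h3, h4, addStep_value q]
    simp only [addStep, List.length_cons, Nat.div2_val, Nat.div_div_eq_div_mul, pow_succ']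
    exact ⟨rfl, trivial, trivial, by omega⟩

theorem PF.addRun {L : α → List Bool} {q : α → ℕ × ℕ × Bool × List Bool} (hL : PF L) (hq : PF q) :
    PF fun a => addRun (L a) (q a) := by
  refine PF.foldl (f := fun _ q _ => Kemeny.addStep q)
    (B := fun a => 2 * esize (q a) + 2 * esize (q a) + 3 + (4 * (esize (L a) + esize (q a)) + 1) + 3)
    hL hq (PF.addStep.comp (PF.fst.comp PF.snd)) ?_ fun a l hl => ?_
  · exact (((((PB.const 2).mul hq.1).add ((PB.const 2).mul hq.1)).add (PB.const 3)).add
      (((PB.const 4).mul (hL.1.add hq.1)).add (PB.const 1))).add (PB.const 3)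
  · obtain ⟨-, h2, h3, h4⟩ := addRun_spec l (q a)
    have e : l.foldl (fun q _ => Kemeny.addStep q) (q a) = Kemeny.addRun l (q a) := rfl
    rw [e, esize_mk, esize_mk (_ : ℕ × Bool × List Bool), esize_mk (_ : Bool × List Bool), h2, h3]
    have b1 := esize_nat_mono (Nat.div_le_self (q a).1 (2 ^ l.length))
    have b2 := esize_nat_mono (Nat.div_le_self (q a).2.1 (2 ^ l.length))
    have b3 := esize_bool_le (Kemeny.addRun l (q a)).2.2.1
    have b4 := (esize_bits (Kemeny.addRun l (q a)).2.2.2).2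
    have b5 := hl.length_le.trans (length_le_esize (L a))
    have b6 := length_le_esize (q a).2.2.2
    have b7 : esize (q a) = esize (q a).1 + (esize (q a).2.1 + (esize (q a).2.2.1 +
      esize (q a).2.2.2 + 1) + 1) + 1 := rfl
    omega

theorem esize_foldl_bit (l : List Bool) (n : ℕ) :
    (l.foldl (fun n d => Nat.bit d n) n).size ≤ n.size + l.length := by
  induction l generalizing n with
  | nil => simp
  | cons d l ih =>
    refine (ih _).trans ?_
    have : (Nat.bit d n).size ≤ n.size + 1 := by
      rw [Nat.size_le, pow_succ, Nat.bit_val]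
      have := Nat.lt_size_self n
      have := Bool.toNat_le d
      omega
    simp; omega

theorem PF.foldl_bit {L : α → List Bool} {n : α → ℕ} (hL : PF L) (hn : PF n) :
    PF fun a => (L a).foldl (fun n d => Nat.bit d n) (n a) := by
  refine PF.foldl (f := fun _ n d => Nat.bit d n) (B := fun a => 4 * (esize (n a) + esize (L a)) + 1)
    hL hn (PF.bit.comp ((PF.snd.comp PF.snd).pair (PF.fst.comp PF.snd)))
    (((PB.const 4).mul (hn.1.add hL.1)).add (PB.const 1)) fun a l hl => ?_
  have h1 := (size_bounds (l.foldl (fun n d => Nat.bit d n) (n a))).2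
  have h2 := esize_foldl_bit l (n a)
  have h3 := (size_bounds (n a)).1
  have h4 := hl.length_le.trans (length_le_esize (L a))
  omega

theorem PF.toNat {c : α → Bool} (hc : PF c) : PF fun a => (c a).toNat :=
  PT.of_enc_eq (PF.cond hc (PF.const 1) (PF.const 0)) fun a => by cases c a <;> rfl

theorem PF.add {f g : α → ℕ} (hf : PF f) (hg : PF g) : PF fun a => f a + g a := by
  -- A clock as long as both numerals together runs until both summands are zero, so that only the
  -- carry is left as high part.
  have hr := PF.addRun ((PF.bits.comp hf).append (PF.bits.comp hg))
    (hf.pair (hg.pair ((PF.const false).pair (PF.const []))))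
  refine PT.of_enc_eq (PF.foldl_bit (PF.snd.comp (PF.snd.comp (PF.snd.comp hr)))
    (PF.toNat (PF.fst.comp (PF.snd.comp (PF.snd.comp hr))))) fun a => ?_
  obtain ⟨h1, h2, h3, -⟩ := addRun_spec ((f a).bits ++ (g a).bits) (f a, g a, false, [])
  have z : ∀ n k : ℕ, n.size ≤ k → n / 2 ^ k = 0 := fun n k h =>
    Nat.div_eq_of_lt ((Nat.lt_size_self n).trans_le (Nat.pow_le_pow_right (by norm_num) h))
  rw [z _ _ (by simp [Nat.size_eq_bits_len])] at h2 h3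
  rw [h2, h3] at h1
  simp only [Nat.zero_add, List.foldl_nil, Bool.toNat_false, Nat.add_zero] at h1
  rw [h1]

/-- Comparison from the least significant digit on. -/
def leRun (l : List Bool) (q : ℕ × ℕ × Bool) : ℕ × ℕ × Bool :=
  l.foldl (fun q _ => (q.1.div2, q.2.1.div2,
    bif Bool.xor q.1.bodd q.2.1.bodd then q.2.1.bodd else q.2.2)) q

/-- The invariant compares lexicographically: the undigested high parts decide, and the flag, which
records ≤ for the low parts, breaks ties. -/
theorem leRun_spec (l : List Bool) (q : ℕ × ℕ × Bool) :
    ((leRun l q).1 < (leRun l q).2.1 ∨ (leRun l q).1 = (leRun l q).2.1 ∧ (leRun l q).2.2 = true ↔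
      q.1 < q.2.1 ∨ q.1 = q.2.1 ∧ q.2.2 = true) ∧
    (leRun l q).1 = q.1 / 2 ^ l.length ∧ (leRun l q).2.1 = q.2.1 / 2 ^ l.length := by
  induction l generalizing q with
  | nil => simp [leRun]
  | cons e l ih =>
    obtain ⟨h1, h2, h3⟩ := ih (q.1.div2, q.2.1.div2,
      bif Bool.xor q.1.bodd q.2.1.bodd then q.2.1.bodd else q.2.2)
    have e1 : leRun (e :: l) q = leRun l (q.1.div2, q.2.1.div2,
      bif Bool.xor q.1.bodd q.2.1.bodd then q.2.1.bodd else q.2.2) := rfl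
    rw [e1]
    refine ⟨h1.trans ?_, ?_, ?_⟩
    · have h1 := Nat.bodd_add_div2 q.1
      have h2 := Nat.bodd_add_div2 q.2.1
      revert h1 h2
      cases q.1.bodd <;> cases q.2.1.bodd <;> cases q.2.2 <;> simp <;> omega
    · rw [h2]; simp only [List.length_cons, Nat.div2_val, Nat.div_div_eq_div_mul, pow_succ']
    · rw [h3]; simp only [List.length_cons, Nat.div2_val, Nat.div_div_eq_div_mul, pow_succ']

theorem PF.leRun {L : α → List Bool} {q : α → ℕ × ℕ × Bool} (hL : PF L) (hq : PF q) :
    PF fun a => leRun (L a) (q a) := by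
  have h1 : PF fun q : α × (ℕ × ℕ × Bool) × Bool => q.2.1.1 := PF.fst.comp (PF.fst.comp PF.snd)
  have h2 : PF fun q : α × (ℕ × ℕ × Bool) × Bool => q.2.1.2.1 :=
    PF.fst.comp (PF.snd.comp (PF.fst.comp PF.snd))
  have h3 : PF fun q : α × (ℕ × ℕ × Bool) × Bool => q.2.1.2.2 :=
    PF.snd.comp (PF.snd.comp (PF.fst.comp PF.snd))
  refine PF.foldl (f := fun _ (q : ℕ × ℕ × Bool) (_ : Bool) => (q.1.div2, q.2.1.div2,
    bif Bool.xor q.1.bodd q.2.1.bodd then q.2.1.bodd else q.2.2))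
    (B := fun a => 2 * esize (q a) + 2 * esize (q a) + 5)
    hL hq ((PF.div2.comp h1).pair ((PF.div2.comp h2).pair
      (PF.cond ((PF.bodd.comp h1).xor (PF.bodd.comp h2)) (PF.bodd.comp h2) h3)))
    ((((PB.const 2).mul hq.1).add ((PB.const 2).mul hq.1)).add (PB.const 5)) fun a l hl => ?_
  obtain ⟨-, h2, h3⟩ := leRun_spec l (q a)
  change esize (Kemeny.leRun l (q a)) ≤ _
  rw [esize_mk, esize_mk (_ : ℕ × Bool), h2, h3]
  have b1 := esize_nat_mono (Nat.div_le_self (q a).1 (2 ^ l.length))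
  have b2 := esize_nat_mono (Nat.div_le_self (q a).2.1 (2 ^ l.length))
  have b3 := esize_bool_le (Kemeny.leRun l (q a)).2.2
  have b7 : esize (q a) = esize (q a).1 + (esize (q a).2.1 + esize (q a).2.2 + 1) + 1 := rfl
  omega

theorem PF.le {f g : α → ℕ} (hf : PF f) (hg : PF g) : PF fun a => decide (f a ≤ g a) := by
  have hr := PF.leRun ((PF.bits.comp hf).append (PF.bits.comp hg))
    (hf.pair (hg.pair (PF.const true)))
  refine PT.of_enc_eq (PF.snd.comp (PF.snd.comp hr)) fun a => ?_
  obtain ⟨h1, h2, h3⟩ := leRun_spec ((f a).bits ++ (g a).bits) (f a, g a, true)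
  have z : ∀ n k : ℕ, n.size ≤ k → n / 2 ^ k = 0 := fun n k h =>
    Nat.div_eq_of_lt ((Nat.lt_size_self n).trans_le (Nat.pow_le_pow_right (by norm_num) h))
  rw [z _ _ (by simp [Nat.size_eq_bits_len])] at h2 h3
  rw [h2, h3] at h1
  congr 1
  rw [Bool.eq_iff_iff, decide_eq_true_iff, le_iff_lt_or_eq]
  simpa using h1

theorem PF.lt {f g : α → ℕ} (hf : PF f) (hg : PF g) : PF fun a => decide (f a < g a) :=
  PT.of_enc_eq (PF.le hg hf).not fun a => by
    congr 1; rw [Bool.eq_iff_iff]; simp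

/-- Horner's scheme yields at most (2^length - 1)·b. The additional `b` on the left avoids the
subtraction and lets the induction close. -/
theorem foldr_mul (b : ℕ) (l : List Bool) :
    l.foldr (fun d n => Nat.bit false n + bif d then b else 0) 0 + b ≤ 2 ^ l.length * b := by
  induction l with
  | nil => simp
  | cons d l ih =>
    have : (bif d then b else 0) ≤ b := by cases d <;> simp
    simp only [List.foldr_cons, Nat.bit_val, List.length_cons, pow_succ', mul_assoc,
      Bool.toNat_false] at ih ⊢
    omega

theorem PF.mul {f g : α → ℕ} (hf : PF f) (hg : PF g) : PF fun a => f a * g a := by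
  have hn : PF fun q : α × Bool × ℕ => q.2.2 := PF.snd.comp PF.snd
  have h : PF fun a => (f a).bits.foldr (fun d n => Nat.bit false n + bif d then g a else 0) 0 := by
    refine PF.foldr (f := fun a d n => Nat.bit false n + bif d then g a else 0)
      (B := fun a => 4 * (esize (f a) + esize (g a)) + 1) (PF.bits.comp hf)
      (PF.const 0) (PF.add (PF.bit.comp ((PF.const false).pair hn))
      (PF.cond (PF.fst.comp PF.snd) (hg.comp PF.fst) (PF.const 0)))
      (((PB.const 4).mul (hf.1.add hg.1)).add (PB.const 1)) fun a l hl => ?_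
    set n := l.foldr (fun d n => Nat.bit false n + bif d then g a else 0) 0 with hn
    have h1 := (size_bounds n).2
    have h2 : n.size ≤ l.length + (g a).size := by
      refine (Nat.size_le_size (Nat.le_of_add_right_le (foldr_mul (g a) l))).trans ?_
      rw [Nat.size_le, pow_add]
      exact Nat.mul_lt_mul_of_pos_left (Nat.lt_size_self _) (by positivity)
    have h3 := (size_bounds (g a)).1
    have h4 := (size_bounds (f a)).1
    have h5 := hl.length_le
    rw [Nat.size_eq_bits_len] at h5
    omega
  refine PT.of_enc_eq h fun a => ?_
  congr 1
  induction f a using Nat.binaryRec' with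
  | zero => simp
  | bit d n h ih =>
    rw [Nat.bits_append_bit n d h, List.foldr_cons, ih, Nat.bit_val, Nat.bit_val]
    cases d <;> simp <;> ring

/-! ### Equality tests -/

/-- Types with a polynomial-time equality test. -/
def PFEq (α : Type) [Enc α] [DecidableEq α] : Prop := PF fun q : α × α => decide (q.1 = q.2)

theorem PFEq.comp [DecidableEq β] (h : PFEq β) {f g : α → β} (hf : PF f) (hg : PF g) :
    PF fun a => decide (f a = g a) :=
  PF.comp (f := fun q : β × β => decide (q.1 = q.2)) h (hf.pair hg)

theorem PFEq.nat : PFEq ℕ :=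
  PT.of_enc_eq ((PF.le PF.fst PF.snd).and (PF.le PF.snd PF.fst)) fun q => by
    congr 1; rw [Bool.eq_iff_iff]; simp; omega

theorem PFEq.prod [DecidableEq α] [DecidableEq β] (h : PFEq α) (h' : PFEq β) : PFEq (α × β) :=
  PT.of_enc_eq ((h.comp (PF.fst.comp PF.fst) (PF.fst.comp PF.snd)).and
    (h'.comp (PF.snd.comp PF.fst) (PF.snd.comp PF.snd))) fun q => by
    congr 1; rw [Bool.eq_iff_iff]; simp [Prod.ext_iff]

/-- Initial segments of length one replace the head function, which would need a default element. -/
theorem PF.take_one : PF fun l : List α => l.take 1 := by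
  have h : PF fun l : List α => ((enc l).hd, Data.nil) :=
    PF.pair (PF.of_hd fun _ => rfl) (PF.const _)
  exact PF.ite_enc (c := fun l : List α => l) PF.id h (PF.const Data.nil)
    (fun l hl => by cases l <;> simp_all [Data.hd]) (fun l hl => by cases l <;> simp_all)

/-- Comparison of a list with an initial segment of the list in the state. -/
def eqRun {α : Type} [DecidableEq α] (l : List α) (q : List α × Bool) : List α × Bool :=
  l.foldl (fun q a => (q.1.tail, q.2 && (q.1.take 1).any fun b => decide (b = a))) q

theorem eqRun_spec {α : Type} [DecidableEq α] (l : List α) (q : List α × Bool) :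
    (eqRun l q).1 = q.1.drop l.length ∧
      ((eqRun l q).2 = true ∧ (eqRun l q).1 = [] ↔ q.2 = true ∧ l = q.1) := by
  induction l generalizing q with
  | nil => obtain ⟨_, _⟩ := q; simp [eqRun, eq_comm]
  | cons a l ih =>
    obtain ⟨h1, h2⟩ := ih (q.1.tail, q.2 && (q.1.take 1).any fun b => decide (b = a))
    refine ⟨h1.trans ?_, h2.trans ?_⟩
    · obtain ⟨_ | ⟨b, l'⟩, c⟩ := q <;> simp
    · obtain ⟨_ | ⟨b, l'⟩, c⟩ := q <;> simp [eq_comm (a := a), and_assoc]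

theorem PFEq.list [DecidableEq α] (h : PFEq α) : PFEq (List α) := by
  have hr : PF fun q : List α × List α => eqRun q.1 (q.2, true) := by
    have h1 : PF fun q : (List α × List α) × (List α × Bool) × α => q.2.1.1 :=
      PF.fst.comp (PF.fst.comp PF.snd)
    have h2 : PF fun q : (List α × List α) × (List α × Bool) × α => q.2.1.2 :=
      PF.snd.comp (PF.fst.comp PF.snd)
    have h3 : PF fun q : (List α × List α) × (List α × Bool) × α => q.2.2 := PF.snd.comp PF.snd
    refine PF.foldl (f := fun _ (q : List α × Bool) (a : α) =>
      (q.1.tail, q.2 && (q.1.take 1).any fun b => decide (b = a))) (B := fun q => esize q + 4)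
      PF.fst (PF.snd.pair (PF.const true))
      ((PF.tail.comp h1).pair (h2.and (PF.any (PF.take_one.comp h1) (h.comp PF.snd (h3.comp PF.fst)))))
      (PB.id.add (PB.const 4)) fun q l hl => ?_
    have e := (eqRun_spec l (q.2, true)).1
    change esize (eqRun l (q.2, true)) ≤ _
    rw [esize_mk, e, esize_mk q]
    have := esize_sublist (List.drop_sublist l.length q.2)
    have := esize_bool_le (eqRun l (q.2, true)).2
    simp only; omega
  refine PT.of_enc_eq ((PF.snd.comp hr).and (PF.isNil.comp (PF.fst.comp hr))) fun q => ?_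
  congr 1
  rw [Bool.eq_iff_iff]
  simpa using (eqRun_spec q.1 (q.2, true)).2

theorem PF.mem [DecidableEq ε] (h : PFEq ε) {f : α → ε} {L : α → List ε} (hf : PF f) (hL : PF L) :
    PF fun a => decide (f a ∈ L a) :=
  PT.of_enc_eq (PF.any (g := fun a e => decide (f a = e)) hL (h.comp (hf.comp PF.fst) PF.snd)) fun a => by
    congr 1; rw [Bool.eq_iff_iff]; simp

/-! ### Removing repetitions, sums, counting, positions and truncation. -/

/-- Each element of a list once. -/
def dedupe {α : Type} [DecidableEq α] (l : List α) : List α :=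
  l.foldr (fun a s => bif decide (a ∈ s) then s else a :: s) []

theorem mem_dedupe {α : Type} [DecidableEq α] {a : α} {l : List α} : a ∈ dedupe l ↔ a ∈ l := by
  induction l with
  | nil => simp [dedupe]
  | cons b l ih =>
    have e : dedupe (b :: l) = bif decide (b ∈ dedupe l) then dedupe l else b :: dedupe l := rfl
    rw [e]
    by_cases h : b ∈ dedupe l
    · simp only [h, decide_true, cond_true, ih, List.mem_cons]
      exact ⟨.inr, fun h' => h'.elim (fun e => e ▸ ih.1 (by rwa [e] at *)) _root_.id⟩
    · simp [h, ih]

theorem nodup_dedupe {α : Type} [DecidableEq α] (l : List α) : (dedupe l).Nodup := by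
  induction l with
  | nil => simp [dedupe]
  | cons b l ih =>
    have e : dedupe (b :: l) = bif decide (b ∈ dedupe l) then dedupe l else b :: dedupe l := rfl
    rw [e]
    by_cases h : b ∈ dedupe l <;> simp [h, ih]

theorem esize_dedupe_le [DecidableEq α] (l : List α) : esize (dedupe l) ≤ esize l := by
  induction l with
  | nil => exact le_rfl
  | cons b l ih =>
    have e : dedupe (b :: l) = bif decide (b ∈ dedupe l) then dedupe l else b :: dedupe l := rfl
    rw [e]
    by_cases h : b ∈ dedupe l <;> simp [h] <;> omega

theorem PF.dedupe [DecidableEq ε] (h : PFEq ε) {L : α → List ε} (hL : PF L) :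
    PF fun a => dedupe (L a) := by
  have hs : PF fun q : α × ε × List ε => q.2.2 := PF.snd.comp PF.snd
  have he : PF fun q : α × ε × List ε => q.2.1 := PF.fst.comp PF.snd
  exact PF.foldr (f := fun _ a s => bif decide (a ∈ s) then s else a :: s) (B := fun a => esize (L a))
    hL (PF.const []) (PF.cond (PF.mem h he hs) hs (he.cons hs)) hL.1
    fun a l hl => (esize_dedupe_le l).trans (esize_sublist hl.sublist)

/-- Sum of a list of numbers. -/
theorem PF.sum {L : α → List ℕ} (hL : PF L) : PF fun a => (L a).sum := by
  have h : PF fun a => (L a).foldr (fun n s => n + s) 0 := by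
    refine PF.foldr (f := fun _ n s => n + s) (B := fun a => 4 * esize (L a) + 1) hL (PF.const 0)
      (PF.add (PF.fst.comp PF.snd) (PF.snd.comp PF.snd))
      (((PB.const 4).mul hL.1).add (PB.const 1)) fun a l hl => ?_
    refine (size_bounds _).2.trans ?_
    have h2 : (l.foldr (fun n s => n + s) 0).size ≤ esize l := by
      clear hl
      induction l with
      | nil => simp
      | cons n l ih =>
        have h1 := size_add_le n (l.foldr (fun n s => n + s) 0)
        have h2 := size_bounds n
        simp only [List.foldr_cons, esize_cons]; omega
    have := esize_sublist hl.sublist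
    omega
  exact PT.of_enc_eq h fun a => rfl

theorem PF.countP {L : α → List ε} {g : α → ε → Bool} (hL : PF L)
    (hg : PF fun q : α × ε => g q.1 q.2) : PF fun a => (L a).countP (g a) := by
  refine PT.of_enc_eq (PF.sum (PF.map (g := fun a e => (g a e).toNat) hL (PF.toNat hg))) fun a => ?_
  congr 1
  induction L a with
  | nil => rfl
  | cons e l ih => cases h : g a e <;> simp [h, ih, add_comm]

theorem PF.idxOf [DecidableEq ε] (h : PFEq ε) {f : α → ε} {L : α → List ε} (hf : PF f) (hL : PF L) :
    PF fun a => (L a).idxOf (f a) := by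
  have he : ∀ (x : ε) (l : List ε),
      l.foldr (fun e n => bif decide (e = x) then 0 else n + 1) 0 = l.idxOf x := fun x l => by
    induction l with
    | nil => rfl
    | cons e l ih =>
      by_cases hx : e = x
      · subst hx; simp
      · simp [hx, ih, List.idxOf_cons_ne]
  have hr : PF fun a => (L a).foldr (fun e n => bif decide (e = f a) then 0 else n + 1) 0 := by
    refine PF.foldr (f := fun a e n => bif decide (e = f a) then 0 else n + 1)
      (B := fun a => 4 * esize (L a) + 1) hL (PF.const 0)
      (PF.cond (h.comp (PF.fst.comp PF.snd) (hf.comp PF.fst)) (PF.const 0)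
        (PF.add (PF.snd.comp PF.snd) (PF.const 1)))
      (((PB.const 4).mul hL.1).add (PB.const 1)) fun a l hl => ?_
    rw [he]
    have h1 := esize_nat_le (l.idxOf (f a))
    have h2 : l.idxOf (f a) ≤ l.length := List.idxOf_le_length
    have h3 := hl.length_le.trans (length_le_esize (L a))
    omega
  exact PT.of_enc_eq hr fun a => by rw [he]

theorem PF.length {L : α → List ε} (hL : PF L) : PF fun a => (L a).length :=
  PT.of_enc_eq (PF.countP (g := fun _ _ => true) hL (PF.const true)) fun a => by simp

theorem foldl_take {ε : Type} (n : ℕ) (l : List ε) :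
    l.foldl (fun s e => bif decide (s.length < n) then s ++ [e] else s) [] = l.take n := by
  induction l using List.reverseRecOn with
  | nil => simp
  | append_singleton l e ih =>
    rw [List.foldl_append, ih]
    by_cases h : l.length < n
    · simp [h, List.take_of_length_le h.le, List.take_of_length_le (show (l ++ [e]).length ≤ n by simpa using h)]
    · simp [List.take_append_of_le_length (not_lt.1 h), not_lt.1 h]

theorem PF.take {n : α → ℕ} {L : α → List ε} (hn : PF n) (hL : PF L) :
    PF fun a => (L a).take (n a) := by
  have hr : PF fun a => (L a).foldl
      (fun s e => bif decide (s.length < n a) then s ++ [e] else s) [] := by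
    have hs : PF fun q : α × List ε × ε => q.2.1 := PF.fst.comp PF.snd
    refine PF.foldl (f := fun a s e => bif decide (s.length < n a) then s ++ [e] else s)
      (B := fun a => esize (L a)) hL (PF.const [])
      (PF.cond (PF.lt (PF.length hs) (hn.comp PF.fst))
        (hs.append ((PF.snd.comp PF.snd).cons (PF.const []))) hs) hL.1 fun a l hl => ?_
    rw [foldl_take]
    exact esize_sublist ((List.take_sublist _ _).trans hl.sublist)
  exact PT.of_enc_eq hr fun a => by rw [foldl_take]

end Kemeny

namespace Kemeny
open Enc

/-! ### The algorithm -/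

/-- Whether `x` comes before `y` in the list `v`. -/
def before (v : List ℕ) (x y : ℕ) : Bool := decide (v.idxOf x < v.idxOf y)

/-- Number of disagreements caused by placing `x` before all elements of `w`. -/
def stepCost (V : List (List ℕ)) (w : List ℕ) (x : ℕ) : ℕ :=
  (V.map fun v => w.countP fun y => before v y x).sum

/-- Kemeny score of a list. -/
def listCost (V : List (List ℕ)) : List ℕ → ℕ
  | [] => 0
  | x :: w => stepCost V w x + listCost V w

/-- Whether all votes place `x` before `y`. -/
def unanimous (V : List (List ℕ)) (x y : ℕ) : Bool := V.all fun v => before v x y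

/-- Whether placing `x` before all elements of `w` respects the unanimity order. -/
def allowed (V : List (List ℕ)) (w : List ℕ) (x : ℕ) : Bool := w.all fun y => !unanimous V y x

/-- Whether `c` is at most `num / den` times the cost of each vote. -/
def within (V : List (List ℕ)) (num den c : ℕ) : Bool :=
  V.all fun v => decide (den * c ≤ num * listCost V v)

/-- `R` without `x`. -/
def remove (R : List ℕ) (x : ℕ) : List ℕ := R.filter fun y => !decide (y = x)

/-- The context of a run: the votes, the approximation factor and the number of rankings. -/
abbrev Ctx : Type := List (List ℕ) × ℕ × ℕ × ℕ

/-- The candidates, in the order of the first vote. -/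
def Ctx.cands (c : Ctx) : List ℕ := c.1.headD []

/-- The states after one more candidate has been placed. A state consists of the remaining
candidates and the cost so far. -/
def expand (c : Ctx) (free : Bool) (T : List (List ℕ × ℕ)) : List (List ℕ × ℕ) :=
  T.flatMap fun q => (q.1.filter fun x => (free || allowed c.1 (remove q.1 x) x) &&
    within c.1 c.2.1 c.2.2.1 (q.2 + stepCost c.1 (remove q.1 x) x)).map
      fun x => (remove q.1 x, q.2 + stepCost c.1 (remove q.1 x) x)

/-- One round of the table computation. -/
def tableStep (c : Ctx) (free : Bool) (T : List (List ℕ × ℕ)) : List (List ℕ × ℕ) :=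
  dedupe (T ++ expand c free T)

/-- The table after a number of rounds given by the length of a list. -/
def tableRun (c : Ctx) (free : Bool) (l : List ℕ) : List (List ℕ × ℕ) :=
  l.foldl (fun T _ => tableStep c free T) [(c.cands, 0)]

/-- The table of all states. -/
def table (c : Ctx) (free : Bool) : List (List ℕ × ℕ) := tableRun c free c.cands

/-- Whether `u` is a final segment of an admissible ranking, given the tables. -/
def extendable (c : Ctx) (T₀ T₁ : List (List ℕ × ℕ)) (u : List ℕ) : Bool :=
  T₁.any fun q => decide (q.1 = c.cands.filter fun y => decide (y ∈ u)) &&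
    T₀.all fun p => !p.1.isEmpty || decide (c.2.2.1 * (q.2 + listCost c.1 u) ≤ c.2.1 * p.2)

/-- Longer final segments of admissible rankings. -/
def grow (c : Ctx) (T₀ T₁ : List (List ℕ × ℕ)) (L : List (List ℕ)) : List (List ℕ) :=
  (L.flatMap fun w => (c.cands.filter fun x => (!decide (x ∈ w) && allowed c.1 w x) &&
    extendable c T₀ T₁ (x :: w)).map fun x => x :: w).take c.2.2.2

/-- Final segments of admissible rankings, of the length of the list `l`. -/
def growRun (c : Ctx) (T₀ T₁ : List (List ℕ × ℕ)) (l : List ℕ) : List (List ℕ) :=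
  l.foldl (fun L _ => grow c T₀ T₁ L)
    ((bif extendable c T₀ T₁ [] then [[]] else []).take c.2.2.2)

/-- The algorithm. -/
def solve (c : Ctx) : List (List ℕ) := growRun c (table c true) (table c false) c.cands

/-! ### The steps of the algorithm take polynomial time -/

variable {α : Type} [Enc α]

theorem PF.before {v : α → List ℕ} {x y : α → ℕ} (hv : PF v) (hx : PF x) (hy : PF y) :
    PF fun a => before (v a) (x a) (y a) :=
  PF.lt (PF.idxOf PFEq.nat hx hv) (PF.idxOf PFEq.nat hy hv)

theorem PF.stepCost {V : α → List (List ℕ)} {w : α → List ℕ} {x : α → ℕ}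
    (hV : PF V) (hw : PF w) (hx : PF x) : PF fun a => stepCost (V a) (w a) (x a) :=
  PF.sum (PF.map (g := fun a v => (w a).countP fun y => Kemeny.before v y (x a)) hV
    (PF.countP (g := fun (q : α × List ℕ) y => Kemeny.before q.2 y (x q.1)) (hw.comp PF.fst)
      (PF.before (PF.snd.comp PF.fst) PF.snd (hx.comp (PF.fst.comp PF.fst)))))

theorem PF.unanimous {V : α → List (List ℕ)} {x y : α → ℕ}
    (hV : PF V) (hx : PF x) (hy : PF y) : PF fun a => unanimous (V a) (x a) (y a) :=
  PF.all (g := fun a v => Kemeny.before v (x a) (y a)) hV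
    (PF.before PF.snd (hx.comp PF.fst) (hy.comp PF.fst))

theorem PF.allowed {V : α → List (List ℕ)} {w : α → List ℕ} {x : α → ℕ}
    (hV : PF V) (hw : PF w) (hx : PF x) : PF fun a => allowed (V a) (w a) (x a) :=
  PF.all (g := fun a y => !Kemeny.unanimous (V a) y (x a)) hw
    (PF.unanimous (hV.comp PF.fst) PF.snd (hx.comp PF.fst)).not

theorem stepCost_le (V : List (List ℕ)) (w : List ℕ) (x : ℕ) :
    stepCost V w x ≤ V.length * w.length := by
  induction V with
  | nil => simp [stepCost]
  | cons v V ih =>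
    have : w.countP (fun y => before v y x) ≤ w.length := List.countP_le_length
    simp only [stepCost, List.map_cons, List.sum_cons, List.length_cons, Nat.succ_mul] at ih ⊢
    omega

/-- Costs are polynomially bounded as numbers, not merely in their bit length. Hence one set of
remaining candidates occurs with only polynomially many costs. -/
theorem listCost_le (V : List (List ℕ)) (w : List ℕ) :
    listCost V w ≤ V.length * w.length * w.length := by
  induction w with
  | nil => simp [listCost]
  | cons x w ih =>
    have h1 := stepCost_le V w x
    simp only [listCost, List.length_cons]
    nlinarith [Nat.zero_le (V.length * w.length)]

theorem PF.listCost {V : α → List (List ℕ)} {w : α → List ℕ} (hV : PF V) (hw : PF w) :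
    PF fun a => listCost (V a) (w a) := by
  have he : ∀ (V : List (List ℕ)) (w : List ℕ),
      -- The fold carries along the suffix already treated, since the cost of the next candidate
      -- depends on it.
      w.foldr (fun x (s : List ℕ × ℕ) => (x :: s.1, Kemeny.stepCost V s.1 x + s.2)) ([], 0) =
        (w, Kemeny.listCost V w) := fun V w => by
    induction w with
    | nil => rfl
    | cons x w ih => rw [List.foldr_cons, ih]; rfl
  have hx : PF fun q : α × ℕ × List ℕ × ℕ => q.2.1 := PF.fst.comp PF.snd
  have hs : PF fun q : α × ℕ × List ℕ × ℕ => q.2.2.1 := PF.fst.comp (PF.snd.comp PF.snd)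
  have hc : PF fun q : α × ℕ × List ℕ × ℕ => q.2.2.2 := PF.snd.comp (PF.snd.comp PF.snd)
  have h : PF fun a => (w a).foldr
      (fun x (s : List ℕ × ℕ) => (x :: s.1, Kemeny.stepCost (V a) s.1 x + s.2)) ([], 0) := by
    refine PF.foldr (f := fun a x (s : List ℕ × ℕ) => (x :: s.1, Kemeny.stepCost (V a) s.1 x + s.2))
      (B := fun a => esize (w a) + (4 * (esize (V a) * esize (w a) * esize (w a)) + 1) + 1)
      hw (PF.const _) ((hx.cons hs).pair (PF.add (PF.stepCost (hV.comp PF.fst) hs hx) hc))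
      ((hw.1.add (((PB.const 4).mul ((hV.1.mul hw.1).mul hw.1)).add (PB.const 1))).add (PB.const 1))
      fun a l hl => ?_
    rw [he, esize_pair]
    have h1 := esize_sublist hl.sublist
    have h2 := esize_nat_le (Kemeny.listCost (V a) l)
    have h3 := listCost_le (V a) l
    have h4 : (V a).length * l.length * l.length ≤ esize (V a) * esize (w a) * esize (w a) := by
      have := hl.length_le.trans (length_le_esize (w a))
      gcongr
      exact length_le_esize (V a)
    omega
  exact PT.of_enc_eq (PF.snd.comp h) fun a => by rw [he]

theorem PF.within {V : α → List (List ℕ)} {n d c : α → ℕ} (hV : PF V) (hn : PF n) (hd : PF d)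
    (hc : PF c) : PF fun a => within (V a) (n a) (d a) (c a) :=
  PF.all (g := fun a v => decide (d a * c a ≤ n a * Kemeny.listCost (V a) v)) hV
    (PF.le ((hd.comp PF.fst).mul (hc.comp PF.fst))
      ((hn.comp PF.fst).mul (PF.listCost (hV.comp PF.fst) PF.snd)))

theorem PF.remove {R : α → List ℕ} {x : α → ℕ} (hR : PF R) (hx : PF x) :
    PF fun a => remove (R a) (x a) :=
  PF.filter (g := fun a y => !decide (y = x a)) hR (PFEq.nat.comp PF.snd (hx.comp PF.fst)).not

theorem PF.headD : PF fun l : List (List ℕ) => l.headD [] := PF.head [] rfl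

theorem PF.cands {c : α → Ctx} (hc : PF c) : PF fun a => (c a).cands :=
  PF.headD.comp (PF.fst.comp hc)

theorem PF.expand {c : α → Ctx} {b : α → Bool} {T : α → List (List ℕ × ℕ)}
    (hc : PF c) (hb : PF b) (hT : PF T) : PF fun a => expand (c a) (b a) (T a) := by
  have hV := PF.fst.comp hc
  have hn := PF.fst.comp (PF.snd.comp hc)
  have hd := PF.fst.comp (PF.snd.comp (PF.snd.comp hc))
  have hR : PF fun q : (α × List ℕ × ℕ) × ℕ => Kemeny.remove q.1.2.1 q.2 :=
    PF.remove (PF.fst.comp (PF.snd.comp PF.fst)) PF.snd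
  have hV' : PF fun q : (α × List ℕ × ℕ) × ℕ => (c q.1.1).1 := hV.comp (PF.fst.comp PF.fst)
  have hC : PF fun q : (α × List ℕ × ℕ) × ℕ =>
      q.1.2.2 + Kemeny.stepCost (c q.1.1).1 (Kemeny.remove q.1.2.1 q.2) q.2 :=
    (PF.snd.comp (PF.snd.comp PF.fst)).add (PF.stepCost hV' hR PF.snd)
  refine PF.flatMap (g := fun a (q : List ℕ × ℕ) => (q.1.filter fun x =>
    (b a || Kemeny.allowed (c a).1 (Kemeny.remove q.1 x) x) &&
    Kemeny.within (c a).1 (c a).2.1 (c a).2.2.1 (q.2 + Kemeny.stepCost (c a).1 (Kemeny.remove q.1 x) x)).map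
      fun x => (Kemeny.remove q.1 x, q.2 + Kemeny.stepCost (c a).1 (Kemeny.remove q.1 x) x)) hT ?_
  refine PF.map (g := fun (q : α × List ℕ × ℕ) x => (Kemeny.remove q.2.1 x,
    q.2.2 + Kemeny.stepCost (c q.1).1 (Kemeny.remove q.2.1 x) x)) ?_ (hR.pair hC)
  exact PF.filter (g := fun (q : α × List ℕ × ℕ) x =>
    (b q.1 || Kemeny.allowed (c q.1).1 (Kemeny.remove q.2.1 x) x) &&
    Kemeny.within (c q.1).1 (c q.1).2.1 (c q.1).2.2.1
      (q.2.2 + Kemeny.stepCost (c q.1).1 (Kemeny.remove q.2.1 x) x)) (PF.fst.comp PF.snd)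
    (((hb.comp (PF.fst.comp PF.fst)).or (PF.allowed hV' hR PF.snd)).and
      (PF.within hV' (hn.comp (PF.fst.comp PF.fst)) (hd.comp (PF.fst.comp PF.fst)) hC))

theorem PF.tableStep {c : α → Ctx} {b : α → Bool} {T : α → List (List ℕ × ℕ)}
    (hc : PF c) (hb : PF b) (hT : PF T) : PF fun a => tableStep (c a) (b a) (T a) :=
  PF.dedupe (PFEq.prod (PFEq.list PFEq.nat) PFEq.nat) (hT.append (PF.expand hc hb hT))

theorem PF.extendable {c : α → Ctx} {T₀ T₁ : α → List (List ℕ × ℕ)} {u : α → List ℕ}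
    (hc : PF c) (h₀ : PF T₀) (h₁ : PF T₁) (hu : PF u) :
    PF fun a => extendable (c a) (T₀ a) (T₁ a) (u a) := by
  have hV := PF.fst.comp hc
  have hn := PF.fst.comp (PF.snd.comp hc)
  have hd := PF.fst.comp (PF.snd.comp (PF.snd.comp hc))
  refine PF.any (g := fun a (q : List ℕ × ℕ) =>
    decide (q.1 = (c a).cands.filter fun y => decide (y ∈ u a)) &&
    (T₀ a).all fun p => !p.1.isEmpty ||
      decide ((c a).2.2.1 * (q.2 + Kemeny.listCost (c a).1 (u a)) ≤ (c a).2.1 * p.2)) h₁ (PF.and ?_ ?_)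
  · refine (PFEq.list PFEq.nat).comp (PF.fst.comp PF.snd) ?_
    exact PF.filter (g := fun (q : α × List ℕ × ℕ) y => decide (y ∈ u q.1))
      ((PF.cands hc).comp PF.fst) (PF.mem PFEq.nat PF.snd (hu.comp (PF.fst.comp PF.fst)))
  · refine PF.all (g := fun (q : α × List ℕ × ℕ) (p : List ℕ × ℕ) => !p.1.isEmpty ||
      decide ((c q.1).2.2.1 * (q.2.2 + Kemeny.listCost (c q.1).1 (u q.1)) ≤ (c q.1).2.1 * p.2))
      (h₀.comp PF.fst) (PF.or ?_ (PF.le ?_ ?_))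
    · exact (PF.isNil.comp (PF.fst.comp PF.snd)).not
    · exact (hd.comp (PF.fst.comp PF.fst)).mul ((PF.snd.comp (PF.snd.comp PF.fst)).add
        (PF.listCost (hV.comp (PF.fst.comp PF.fst)) (hu.comp (PF.fst.comp PF.fst))))
    · exact (hn.comp (PF.fst.comp PF.fst)).mul (PF.snd.comp PF.snd)

theorem PF.grow {c : α → Ctx} {T₀ T₁ : α → List (List ℕ × ℕ)} {L : α → List (List ℕ)}
    (hc : PF c) (h₀ : PF T₀) (h₁ : PF T₁) (hL : PF L) :
    PF fun a => grow (c a) (T₀ a) (T₁ a) (L a) := by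
  have hV := PF.fst.comp hc
  have hr := PF.snd.comp (PF.snd.comp (PF.snd.comp hc))
  have hp : PF fun q : (α × List ℕ) × ℕ => q.1.1 := PF.fst.comp PF.fst
  have hw : PF fun q : (α × List ℕ) × ℕ => q.1.2 := PF.snd.comp PF.fst
  refine PF.take hr (PF.flatMap (g := fun a w => ((c a).cands.filter fun x =>
    (!decide (x ∈ w) && Kemeny.allowed (c a).1 w x) &&
    Kemeny.extendable (c a) (T₀ a) (T₁ a) (x :: w)).map fun x => x :: w) hL ?_)
  refine PF.map (g := fun (q : α × List ℕ) x => x :: q.2) ?_ (PF.snd.cons hw)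
  exact PF.filter (g := fun (q : α × List ℕ) x =>
    (!decide (x ∈ q.2) && Kemeny.allowed (c q.1).1 q.2 x) &&
    Kemeny.extendable (c q.1) (T₀ q.1) (T₁ q.1) (x :: q.2)) ((PF.cands hc).comp PF.fst)
    (((PF.mem PFEq.nat PF.snd hw).not.and (PF.allowed (hV.comp hp) hw PF.snd)).and
      (PF.extendable (hc.comp hp) (h₀.comp hp) (h₁.comp hp) (PF.snd.cons hw)))

/-- The algorithm runs in time polynomial in any measure that bounds the input, the tables and the
lists of final segments. -/
theorem PT.solve {ι : Type} {sz : ι → ℕ} {x : ι → α} {c : ι → Ctx} {B : ι → ℕ} (hc : PT sz x c)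
    (hB : PB sz B) (hT : ∀ i b l, l <+: (c i).cands → esize (tableRun (c i) b l) ≤ B i)
    (hG : ∀ i l, l <+: (c i).cands →
      esize (growRun (c i) (table (c i) true) (table (c i) false) l) ≤ B i) :
    PT sz x fun i => solve (c i) := by
  have hcands : PT sz x fun i => (c i).cands := hc.comp (PF.cands PF.id)
  have table : ∀ b, PT sz x fun i => table (c i) b := fun b => by
    have s0 : PF fun c : Ctx => [(c.cands, 0)] :=
      ((PF.cands PF.id).pair (PF.const 0)).cons (PF.const [])
    exact PT.foldl (f := fun c T (_ : ℕ) => Kemeny.tableStep c b T) hc (hc.comp s0) hcands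
      (PF.tableStep PF.fst (PF.const b) (PF.fst.comp PF.snd)) hB fun i l hl => hT i b l hl
  have ht := table true
  have hf := table false
  have s0 : PF fun q : Ctx × List (List ℕ × ℕ) × List (List ℕ × ℕ) =>
      (bif extendable q.1 q.2.1 q.2.2 [] then [([] : List ℕ)] else []).take q.1.2.2.2 :=
    PF.take (PF.snd.comp (PF.snd.comp (PF.snd.comp PF.fst)))
      (PF.cond (PF.extendable PF.fst (PF.fst.comp PF.snd) (PF.snd.comp PF.snd) (PF.const []))
        (PF.const _) (PF.const _))
  have hctx := hc.pair (ht.pair hf)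
  exact PT.foldl (f := fun (q : Ctx × List (List ℕ × ℕ) × List (List ℕ × ℕ)) L (_ : ℕ) =>
    Kemeny.grow q.1 q.2.1 q.2.2 L) hctx (hctx.comp s0) hcands
    (PF.grow (PF.fst.comp PF.fst) (PF.fst.comp (PF.snd.comp PF.fst))
      (PF.snd.comp (PF.snd.comp PF.fst)) (PF.fst.comp PF.snd)) hB fun i l hl => hG i l hl

end Kemeny

namespace Kemeny

/-! ### Correctness of the algorithm for lists -/

/-- Cost of the part `p` of a list that starts with `p` and continues with the elements of `R`. -/
def prefCost (V : List (List ℕ)) : List ℕ → List ℕ → ℕ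
  | [], _ => 0
  | x :: p, R => stepCost V (p ++ R) x + prefCost V p R

/-- Whether the part `p` of a list that starts with `p` and continues with the elements of `R`
respects the unanimity order. -/
def prefAllowed (V : List (List ℕ)) : List ℕ → List ℕ → Prop
  | [], _ => True
  | x :: p, R => allowed V (p ++ R) x = true ∧ prefAllowed V p R

variable {V : List (List ℕ)}

theorem prefCost_append (p q R : List ℕ) :
    prefCost V (p ++ q) R = prefCost V p (q ++ R) + prefCost V q R := by
  induction p with
  | nil => simp [prefCost]
  | cons x p ih => simp [prefCost, ih, add_assoc]

theorem prefAllowed_append (p q R : List ℕ) :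
    prefAllowed V (p ++ q) R ↔ prefAllowed V p (q ++ R) ∧ prefAllowed V q R := by
  induction p with
  | nil => simp [prefAllowed]
  | cons x p ih => simp [prefAllowed, ih, and_assoc]

theorem listCost_eq (w : List ℕ) : listCost V w = prefCost V w [] := by
  induction w with
  | nil => rfl
  | cons x w ih => simp [prefCost, listCost, ih]

theorem listCost_append (p w : List ℕ) : listCost V (p ++ w) = prefCost V p w + listCost V w := by
  simp [listCost_eq, prefCost_append]

theorem stepCost_perm {w w' : List ℕ} (h : w.Perm w') (x : ℕ) : stepCost V w x = stepCost V w' x := by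
  simp only [stepCost, h.countP_eq]

theorem allowed_iff {w : List ℕ} {x : ℕ} :
    allowed V w x = true ↔ ∀ y ∈ w, unanimous V y x = false := by simp [allowed]

theorem allowed_perm {w w' : List ℕ} (h : w.Perm w') (x : ℕ) :
    allowed V w x = true ↔ allowed V w' x = true := by
  simp only [allowed_iff, h.mem_iff]

/-- The cost of a prefix depends on the rest only as a set, so the dynamic program may forget the
order of the rest. -/
theorem prefCost_perm {R R' : List ℕ} (h : R.Perm R') (p : List ℕ) :
    prefCost V p R = prefCost V p R' := by
  induction p with
  | nil => rfl
  | cons x p ih => rw [prefCost, prefCost, ih, stepCost_perm (h.append_left p)]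

theorem prefAllowed_perm {R R' : List ℕ} (h : R.Perm R') (p : List ℕ) :
    prefAllowed V p R ↔ prefAllowed V p R' := by
  induction p with
  | nil => rfl
  | cons x p ih => rw [prefAllowed, prefAllowed, ih, allowed_perm (h.append_left p)]

theorem prefAllowed_iff_pairwise (w : List ℕ) :
    prefAllowed V w [] ↔ w.Pairwise fun x y => unanimous V y x = false := by
  induction w with
  | nil => simp [prefAllowed]
  | cons x w ih => simp [prefAllowed, ih, allowed_iff]

theorem remove_perm {R : List ℕ} (hR : R.Nodup) {x : ℕ} (hx : x ∈ R) : (x :: remove R x).Perm R := by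
  have : remove R x = R.erase x := by
    rw [hR.erase_eq_filter]
    exact List.filter_congr fun y _ => by simp [bne, BEq.beq]
  rw [this]
  exact (List.perm_cons_erase hx).symm

theorem within_iff {n d c : ℕ} : within V n d c = true ↔ ∀ v ∈ V, d * c ≤ n * listCost V v := by
  simp [within]

/-- Every prefix of an affordable list is affordable, so pruning by cost never cuts off an
affordable list early. -/
theorem within_mono {n d c c' : ℕ} (h : within V n d c' = true) (hc : c ≤ c') :
    within V n d c = true :=
  within_iff.2 fun v hv => (Nat.mul_le_mul_left d hc).trans (within_iff.1 h v hv)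

/-! ### Soundness and completeness of the tables. -/

/-- Contexts that represent instances. -/
structure Ctx.Good (c : Ctx) : Prop where
  ne : c.1 ≠ []
  nodup : c.cands.Nodup
  perm : ∀ v ∈ c.1, v.Perm c.cands
  le : c.2.2.1 ≤ c.2.1

/-- The states that the table computation is to find. -/
def IsState (c : Ctx) (free : Bool) (q : List ℕ × ℕ) : Prop :=
  ∃ p : List ℕ, (p ++ q.1).Perm c.cands ∧ q.1 = c.cands.filter (fun y => decide (y ∉ p)) ∧
    (free = true ∨ prefAllowed c.1 p q.1) ∧ q.2 = prefCost c.1 p q.1 ∧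
      within c.1 c.2.1 c.2.2.1 q.2 = true

theorem tableRun_append (c : Ctx) (free : Bool) (l : List ℕ) (e : ℕ) :
    tableRun c free (l ++ [e]) = tableStep c free (tableRun c free l) := by
  simp [tableRun]

theorem mem_expand {c : Ctx} {free : Bool} {T : List (List ℕ × ℕ)} {q' : List ℕ × ℕ} :
    q' ∈ expand c free T ↔ ∃ q ∈ T, ∃ x ∈ q.1, (free = true ∨ allowed c.1 (remove q.1 x) x = true) ∧
      within c.1 c.2.1 c.2.2.1 (q.2 + stepCost c.1 (remove q.1 x) x) = true ∧
      (remove q.1 x, q.2 + stepCost c.1 (remove q.1 x) x) = q' := by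
  simp [expand, and_assoc]

theorem filter_append_singleton (C p : List ℕ) (x : ℕ) :
    C.filter (fun y => decide (y ∉ p ++ [x])) = remove (C.filter fun y => decide (y ∉ p)) x := by
  rw [remove, List.filter_filter]
  exact List.filter_congr fun y _ => by simp [and_comm]

/-- Soundness: every entry is witnessed by a concrete prefix. The remaining candidates are kept in
the order of the first vote, so equal sets are equal lists and can be looked up. -/
theorem isState_of_mem_tableRun {c : Ctx} (hc : c.Good) (free : Bool) (l : List ℕ) :
    ∀ q ∈ tableRun c free l, IsState c free q := by
  induction l using List.reverseRecOn with
  | nil =>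
    intro q hq
    obtain rfl : q = (c.cands, 0) := by simpa [tableRun] using hq
    exact ⟨[], by simp, by simp, .inr trivial, rfl, by simp [within_iff]⟩
  | append_singleton l e ih =>
    intro q hq
    rw [tableRun_append, tableStep, mem_dedupe, List.mem_append, mem_expand] at hq
    rcases hq with hq | ⟨q, hq, x, hx, ha, hw, rfl⟩
    · exact ih q hq
    · obtain ⟨p, h1, h2, h3, h4, -⟩ := ih q hq
      have hp : (x :: remove q.1 x).Perm q.1 := remove_perm (h2 ▸ hc.nodup.filter _) hx
      refine ⟨p ++ [x], ?_, ?_, ?_, ?_, hw⟩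
      · simpa using (hp.append_left p).trans h1
      · rw [filter_append_singleton, ← h2]
      · by_cases hf : free = true
        · exact .inl hf
        · right
          rw [prefAllowed_append]
          refine ⟨(prefAllowed_perm hp p).2 (h3.resolve_left hf), ?_⟩
          simpa [prefAllowed] using ha.resolve_left hf
      · simp only [prefCost_append]
        rw [List.singleton_append, prefCost_perm hp p, h4]
        simp [prefCost]

/-- Completeness, by removing the last candidate of the prefix: the shorter prefix costs no more,
hence was not pruned, and one expansion step leads back. -/
theorem mem_tableRun {c : Ctx} (hc : c.Good) (free : Bool) (p w : List ℕ)
    (hp : (p ++ w).Perm c.cands) (ha : free = true ∨ prefAllowed c.1 p w)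
    (hw : within c.1 c.2.1 c.2.2.1 (prefCost c.1 p w) = true) (l : List ℕ) (hl : p.length ≤ l.length) :
    (c.cands.filter (fun y => decide (y ∉ p)), prefCost c.1 p w) ∈ tableRun c free l := by
  induction l using List.reverseRecOn generalizing p w with
  | nil =>
    obtain rfl : p = [] := by simpa using hl
    simp [tableRun, prefCost]
  | append_singleton l e ih =>
    rw [tableRun_append, tableStep, mem_dedupe, List.mem_append, mem_expand]
    -- The table is cumulative, so shorter prefixes are already present; only those of exactly the
    -- new length need an expansion.
    by_cases h : p.length ≤ l.length
    · exact .inl (ih p w hp ha hw h)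
    · induction p using List.reverseRecOn with
      | nil => simp at h
      | append_singleton p x _ =>
        have hp' : (p ++ x :: w).Perm c.cands := by simpa using hp
        have hnd : (p ++ x :: w).Nodup := hp'.nodup_iff.2 hc.nodup
        have hrp : (remove (c.cands.filter fun y => decide (y ∉ p)) x).Perm w := by
          rw [← filter_append_singleton]
          rw [List.perm_ext_iff_of_nodup (hc.nodup.filter _) 
            (List.nodup_append.1 (hp.nodup_iff.2 hc.nodup)).2.1]
          intro y
          have hm := hp.mem_iff (a := y)
          have hd := (List.nodup_append.1 (hp.nodup_iff.2 hc.nodup)).2.2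
          simp only [List.mem_filter, ← hm, List.mem_append (s := p ++ [x]), decide_eq_true_iff]
          exact ⟨fun h => h.1.resolve_left h.2, fun h => ⟨.inr h, fun h' => hd y h' y h rfl⟩⟩
        simp only [prefCost_append, List.singleton_append, prefAllowed_append] at ha hw ⊢
        have hs := ih p (x :: w) hp' (ha.imp_right And.left)
          (within_mono hw (Nat.le_add_right _ _)) (by simp at hl; omega)
        refine .inr ⟨_, hs, x, ?_, ha.imp_right fun h => ?_, ?_, ?_⟩
        · simp only [List.mem_filter, decide_eq_true_iff]
          exact ⟨hp'.subset (by simp), fun h => (List.nodup_append.1 hnd).2.2 x h x (by simp) rfl⟩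
        · rw [allowed_perm hrp]
          simpa [prefAllowed] using h.2
        · rw [stepCost_perm hrp]
          simpa [prefCost] using hw
        · rw [filter_append_singleton, stepCost_perm hrp]
          simp [prefCost]

/-- The admissible lists. -/
def Ctx.Adm (c : Ctx) (u : List ℕ) : Prop :=
  u.Perm c.cands ∧ prefAllowed c.1 u [] ∧
    ∀ u' : List ℕ, u'.Perm c.cands → c.2.2.1 * listCost c.1 u ≤ c.2.1 * listCost c.1 u'

/-- A prefix for `u` matters only through its cost, so a lookup in the unanimity table decides
whether one exists. Comparing with all complete states of the free table amounts to comparing with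
the optimum. -/
theorem extendable_iff {c : Ctx} (hc : c.Good) {u : List ℕ} (hu : u.Nodup) (hs : u ⊆ c.cands)
    (ha : prefAllowed c.1 u []) :
    extendable c (table c true) (table c false) u = true ↔ ∃ p, c.Adm (p ++ u) := by
  have hperm : (c.cands.filter fun y => decide (y ∈ u)).Perm u := by
    rw [List.perm_ext_iff_of_nodup (hc.nodup.filter _) hu]
    intro y
    simpa using fun h => hs h
  have hle : ∀ p : List ℕ, p.Perm c.cands → p.length ≤ c.cands.length := fun p h => h.length_eq.le
  simp only [extendable, List.any_eq_true, List.all_eq_true, Bool.and_eq_true, decide_eq_true_iff,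
    Bool.or_eq_true, Bool.not_eq_true']
  constructor
  · rintro ⟨q, hq, hR, hT⟩
    obtain ⟨p, h1, h2, h3, h4, -⟩ := isState_of_mem_tableRun hc false _ q hq
    have hqu : q.1.Perm u := hR ▸ hperm
    refine ⟨p, (hqu.append_left p).symm.trans h1, ?_, fun u' hu' => ?_⟩
    · rw [prefAllowed_append]
      refine ⟨?_, ha⟩
      rw [List.append_nil, ← prefAllowed_perm hqu]
      simpa using h3
    · rw [listCost_append, ← prefCost_perm hqu, ← h4]
      -- An optimal list costs at most as much as any vote, and the factor is at least 1 by `hc.le`.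
      -- So it survives pruning and is one of the complete states that `hT` speaks about.
      obtain ⟨u₀, hu₀, hmin⟩ : ∃ u₀ : List ℕ, u₀.Perm c.cands ∧
          ∀ u' : List ℕ, u'.Perm c.cands → listCost c.1 u₀ ≤ listCost c.1 u' := by
        obtain ⟨u₀, h0, hm⟩ := (measure (listCost c.1)).wf.has_min {u | u.Perm c.cands}
          ⟨c.cands, List.Perm.refl _⟩
        exact ⟨u₀, h0, fun u' hu' => not_lt.1 (hm u' hu')⟩
      have hmem := mem_tableRun hc true u₀ [] (by simpa using hu₀) (.inl rfl)
        (within_iff.2 fun v hv => by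
          rw [← listCost_eq]
          exact Nat.mul_le_mul hc.le (hmin v (hc.perm v hv))) c.cands (hle _ hu₀)
      have hnil : c.cands.filter (fun y => decide (y ∉ u₀)) = [] := by
        rw [List.filter_eq_nil_iff]
        intro y hy
        simpa using hu₀.symm.subset hy
      have := (hT _ hmem).resolve_left (by simp only [hnil]; simp)
      rw [← listCost_eq] at this
      exact this.trans (Nat.mul_le_mul_left _ (hmin u' hu'))
  · rintro ⟨p, hp, hap, hle'⟩
    rw [prefAllowed_append, List.append_nil] at hap
    have hfil : c.cands.filter (fun y => decide (y ∉ p)) = c.cands.filter fun y => decide (y ∈ u) := by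
      refine List.filter_congr fun y hy => ?_
      have hd := (List.nodup_append.1 (hp.nodup_iff.2 hc.nodup)).2.2
      rw [← hp.mem_iff, List.mem_append] at hy
      rw [decide_eq_decide]
      exact ⟨hy.resolve_left, fun h h' => hd y h' y h rfl⟩
    -- The votes are themselves competitors in `hle'`, so admissibility of `p ++ u` keeps the cost
    -- of `p` within the pruning bound.
    have hmem := mem_tableRun hc false p u hp (.inr hap.1) (within_iff.2 fun v hv => by
      refine (Nat.mul_le_mul_left _ ?_).trans (hle' v (hc.perm v hv))
      rw [listCost_append]; omega) c.cands
      ((List.length_append (as := p) ▸ hle _ hp) |> fun h => by omega)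
    refine ⟨_, hmem, hfil, fun q hq => ?_⟩
    obtain ⟨p', h1, -, -, h4, -⟩ := isState_of_mem_tableRun hc true _ q hq
    by_cases hn : q.1 = []
    · right
      rw [← listCost_append, h4, hn, ← listCost_eq]
      exact hle' p' (by simpa [hn] using h1)
    · left; simpa using hn

/-! ### Enumeration of final segments without dead ends. -/

/-- Final segments of admissible lists. -/
def Ctx.Ext (c : Ctx) (u : List ℕ) : Prop := ∃ p, c.Adm (p ++ u)

theorem Ctx.Ext.nodup {c : Ctx} (hc : c.Good) {u : List ℕ} (h : c.Ext u) : u.Nodup := by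
  obtain ⟨p, hp, -, -⟩ := h
  exact (hp.nodup_iff.2 hc.nodup).sublist (by simp)

theorem Ctx.Ext.subset {c : Ctx} {u : List ℕ} (h : c.Ext u) : u ⊆ c.cands := by
  obtain ⟨p, hp, -, -⟩ := h
  exact fun x hx => hp.subset (by simp [hx])

theorem Ctx.Ext.allowed {c : Ctx} {u : List ℕ} (h : c.Ext u) : prefAllowed c.1 u [] := by
  obtain ⟨p, -, ha, -⟩ := h
  exact ((prefAllowed_append _ _ _).1 ha).2

theorem Ctx.Ext.of_cons {c : Ctx} {x : ℕ} {u : List ℕ} (h : c.Ext (x :: u)) : c.Ext u := by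
  obtain ⟨p, hp⟩ := h
  exact ⟨p ++ [x], by simpa using hp⟩

theorem Ctx.Ext.exists_cons {c : Ctx} {u : List ℕ} (h : c.Ext u) (hl : u.length < c.cands.length) :
    ∃ x, c.Ext (x :: u) := by
  obtain ⟨p, hp⟩ := h
  induction p using List.reverseRecOn with
  | nil =>
    have := hp.1.length_eq
    simp at this; omega
  | append_singleton p x _ => exact ⟨x, p, by simpa using hp⟩

theorem ext_iff_adm {c : Ctx} {u : List ℕ} (hl : u.length = c.cands.length) : c.Ext u ↔ c.Adm u := by
  refine ⟨fun ⟨p, hp⟩ => ?_, fun h => ⟨[], h⟩⟩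
  have := hp.1.length_eq
  obtain rfl : p = [] := by
    rw [List.length_append] at this
    exact List.eq_nil_of_length_eq_zero (by omega)
  simpa using hp

theorem mem_grow_flatMap {c : Ctx} (hc : c.Good) {L : List (List ℕ)} (hL : ∀ w ∈ L, c.Ext w)
    (u : List ℕ) :
    (u ∈ L.flatMap fun w => (c.cands.filter fun x => (!decide (x ∈ w) && allowed c.1 w x) &&
      extendable c (table c true) (table c false) (x :: w)).map fun x => x :: w) ↔
      ∃ x, ∃ w ∈ L, u = x :: w ∧ c.Ext (x :: w) := by
  simp only [List.mem_flatMap, List.mem_map, List.mem_filter, Bool.and_eq_true, Bool.not_eq_true',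
    decide_eq_false_iff_not]
  constructor
  · rintro ⟨w, hw, x, ⟨hx, ⟨hxw, ha⟩, he⟩, rfl⟩
    have hE := hL w hw
    exact ⟨x, w, hw, rfl, (extendable_iff hc (List.nodup_cons.2 ⟨hxw, hE.nodup hc⟩)
      (List.cons_subset.2 ⟨hx, hE.subset⟩) ⟨by simpa using ha, hE.allowed⟩).1 he⟩
  · rintro ⟨x, w, hw, rfl, hE⟩
    have hn := List.nodup_cons.1 (hE.nodup hc)
    exact ⟨w, hw, x, ⟨hE.subset (by simp), ⟨hn.1, by simpa using hE.allowed.1⟩,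
      (extendable_iff hc (hE.nodup hc) hE.subset hE.allowed).2 hE⟩, rfl⟩

/-- The partial results: `r` of the final segments of length `k`, or all of them. -/
def IsPartial (c : Ctx) (k : ℕ) (L : List (List ℕ)) : Prop :=
  L.Nodup ∧ (∀ w ∈ L, w.length = k ∧ c.Ext w) ∧ L.length ≤ c.2.2.2 ∧
    (L.length = c.2.2.2 ∨ ∀ w : List ℕ, w.length = k → c.Ext w → w ∈ L)

theorem isPartial_take {c : Ctx} {k : ℕ} {L : List (List ℕ)} (hn : L.Nodup)
    (hm : ∀ w ∈ L, w.length = k ∧ c.Ext w)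
    (h : c.2.2.2 ≤ L.length ∨ ∀ w : List ℕ, w.length = k → c.Ext w → w ∈ L) :
    IsPartial c k (L.take c.2.2.2) := by
  refine ⟨hn.sublist (List.take_sublist _ _), fun w hw => hm w (List.mem_of_mem_take hw),
    by simp, ?_⟩
  by_cases hl : c.2.2.2 ≤ L.length
  · left; simpa using hl
  · right
    rw [List.take_of_length_le (not_le.1 hl).le]
    exact h.resolve_left hl

/-- Each segment shorter than a full list can be prolonged, and different segments have different
prolongations. So a list of `r` segments stays at `r` after truncation, and a complete list yields
all longer segments. -/
theorem isPartial_grow {c : Ctx} (hc : c.Good) {k : ℕ} (hk : k < c.cands.length)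
    {L : List (List ℕ)} (hL : IsPartial c k L) :
    IsPartial c (k + 1) (grow c (table c true) (table c false) L) ∧
      L.length ≤ (grow c (table c true) (table c false) L).length := by
  obtain ⟨h1, h2, h3, h4⟩ := hL
  have hmem := mem_grow_flatMap hc fun w hw => (h2 w hw).2
  set M := L.flatMap fun w => (c.cands.filter fun x => (!decide (x ∈ w) && allowed c.1 w x) &&
      extendable c (table c true) (table c false) (x :: w)).map fun x => x :: w with hM
  -- Deleting the first entry maps the prolongations onto a list that contains every element of `L`.
  have hle : L.length ≤ M.length := by
    have hs : L ⊆ M.map List.tail := fun w hw => by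
      obtain ⟨x, hx⟩ := (h2 w hw).2.exists_cons ((h2 w hw).1 ▸ hk)
      exact List.mem_map.2 ⟨x :: w, (hmem _).2 ⟨x, w, hw, rfl, hx⟩, rfl⟩
    simpa using (List.subperm_of_subset h1 hs).length_le
  have hg : grow c (table c true) (table c false) L = M.take c.2.2.2 := rfl
  rw [hg]
  refine ⟨isPartial_take ?_ ?_ ?_, by simpa using ⟨h3, hle⟩⟩
  · rw [hM, List.nodup_flatMap]
    refine ⟨fun w _ => (hc.nodup.filter _).map (fun a b h => (List.cons.inj h).1), h1.imp fun hw => ?_⟩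
    intro u hu hu'
    simp only [List.mem_map] at hu hu'
    obtain ⟨x, -, rfl⟩ := hu
    obtain ⟨y, -, h⟩ := hu'
    exact hw (List.cons.inj h).2.symm
  · intro u hu
    obtain ⟨x, w, hw, rfl, hE⟩ := (hmem u).1 hu
    exact ⟨by simp [(h2 w hw).1], hE⟩
  · refine h4.imp (fun h => h.ge.trans hle) fun h u hu hE => ?_
    obtain ⟨x, w, rfl⟩ := List.exists_cons_of_length_eq_add_one hu
    exact (hmem _).2 ⟨x, w, h w (by simpa using hu) hE.of_cons, rfl, hE⟩

theorem growRun_append (c : Ctx) (T₀ T₁ : List (List ℕ × ℕ)) (l : List ℕ) (e : ℕ) :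
    growRun c T₀ T₁ (l ++ [e]) = grow c T₀ T₁ (growRun c T₀ T₁ l) := by
  simp [growRun]

theorem isPartial_growRun {c : Ctx} (hc : c.Good) (l : List ℕ) (hl : l.length ≤ c.cands.length) :
    IsPartial c l.length (growRun c (table c true) (table c false) l) := by
  induction l using List.reverseRecOn with
  | nil =>
    have he := extendable_iff hc (u := []) (by simp) (by simp) trivial
    refine isPartial_take ?_ ?_ ?_
    · cases extendable c (table c true) (table c false) [] <;> simp
    · intro w hw
      cases h : extendable c (table c true) (table c false) [] <;> rw [h] at hw
      · simp at hw
      · obtain rfl : w = [] := by simpa using hw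
        exact ⟨rfl, he.1 h⟩
    · right
      intro w hw hE
      obtain rfl : w = [] := by simpa using hw
      simp [he.2 hE]
  | append_singleton l e ih =>
    rw [List.length_append] at hl ⊢
    rw [growRun_append]
    exact (isPartial_grow hc (by simpa using hl) (ih (by omega))).1

/-- Monotonicity bounds every intermediate list by the output, which makes the running time depend
on ℓ and not on `r`, a number given in binary. -/
theorem length_growRun_le {c : Ctx} (hc : c.Good) (l l' : List ℕ)
    (hl : (l ++ l').length ≤ c.cands.length) :
    (growRun c (table c true) (table c false) l).length ≤
      (growRun c (table c true) (table c false) (l ++ l')).length := by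
  induction l' using List.reverseRecOn with
  | nil => simp
  | append_singleton l' e ih =>
    rw [← List.append_assoc, List.length_append] at hl
    rw [← List.append_assoc, growRun_append]
    exact (ih (by omega)).trans
      (isPartial_grow hc (by simpa using hl) (isPartial_growRun hc _ (by omega))).2

theorem solve_spec {c : Ctx} (hc : c.Good) :
    (solve c).Nodup ∧ (∀ u ∈ solve c, c.Adm u) ∧ (solve c).length ≤ c.2.2.2 ∧
      ((solve c).length = c.2.2.2 ∨ ∀ u, c.Adm u → u ∈ solve c) := by
  obtain ⟨h1, h2, h3, h4⟩ := isPartial_growRun hc c.cands le_rfl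
  exact ⟨h1, fun u hu => (ext_iff_adm (h2 u hu).1).1 (h2 u hu).2, h3, h4.imp_right fun h u hu =>
    h u hu.1.length_eq ((ext_iff_adm hu.1.length_eq).2 hu)⟩

end Kemeny

namespace Kemeny
open Enc

/-! ### Rankings as lists -/

/-- A ranking as a list of numbers. -/
def toWord {m : ℕ} (π : Ranking m) : List ℕ := List.ofFn fun i : Fin m => (π.symm i : ℕ)

variable {m : ℕ}

theorem enc_toWord (π : Ranking m) : enc (toWord π) = Data.ofRanking π := by
  change Data.ofList ((toWord π).map Data.ofNat) = _
  rw [toWord, List.map_ofFn]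
  rfl

theorem enc_map_toWord (l : List (Ranking m)) : enc (l.map toWord) = Data.ofRankings l := by
  change Data.ofList ((l.map toWord).map enc) = Data.ofList (l.map Data.ofRanking)
  rw [List.map_map]
  congr 1
  exact List.map_congr_left fun π _ => enc_toWord π

theorem toWord_injective : Function.Injective (toWord : Ranking m → List ℕ) := fun π σ h => by
  have := List.ofFn_injective h
  have h2 : π.symm = σ.symm := Equiv.ext fun i => Fin.ext (congrFun this i)
  simpa using congrArg Equiv.symm h2

theorem nodup_toWord (π : Ranking m) : (toWord π).Nodup :=
  List.nodup_ofFn.2 (Fin.val_injective.comp π.symm.injective)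

theorem mem_toWord (π : Ranking m) (x : ℕ) : x ∈ toWord π ↔ x < m := by
  rw [toWord, List.mem_ofFn]
  exact ⟨fun ⟨i, hi⟩ => hi ▸ (π.symm i).2, fun h => ⟨π ⟨x, h⟩, by simp⟩⟩

theorem length_toWord (π : Ranking m) : (toWord π).length = m := by simp [toWord]

theorem toWord_perm (π σ : Ranking m) : (toWord π).Perm (toWord σ) :=
  (List.perm_ext_iff_of_nodup (nodup_toWord π) (nodup_toWord σ)).2 fun x => by simp [mem_toWord]

theorem exists_toWord {u : List ℕ} {σ : Ranking m} (h : u.Perm (toWord σ)) : ∃ π : Ranking m, toWord π = u := by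
  have hl : u.length = m := h.length_eq.trans (length_toWord σ)
  have hn : u.Nodup := h.nodup_iff.2 (nodup_toWord σ)
  have hm : ∀ x ∈ u, x < m := fun x hx => (mem_toWord σ x).1 (h.subset hx)
  let f : Fin m → Fin m := fun i => ⟨u[(i : ℕ)]'(by omega), hm _ (List.getElem_mem _)⟩
  have hf : Function.Injective f := fun i j hij => by
    have : u[(i : ℕ)]'(by omega) = u[(j : ℕ)]'(by omega) := congrArg Fin.val hij
    exact Fin.ext ((hn.getElem_inj_iff).1 this)
  refine ⟨(Equiv.ofBijective f (Finite.injective_iff_bijective.1 hf)).symm, ?_⟩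
  refine List.ext_getElem (by simp [toWord, hl]) fun i h1 h2 => ?_
  simp [toWord, f]

theorem idxOf_toWord (π : Ranking m) (x : Fin m) : (toWord π).idxOf (x : ℕ) = (π x : ℕ) := by
  have hlt : (π x : ℕ) < (toWord π).length := by rw [length_toWord]; exact (π x).2
  have h : (toWord π)[(π x : ℕ)] = (x : ℕ) := by simp [toWord]
  conv_lhs => rw [← h]
  exact (nodup_toWord π).idxOf_getElem _ hlt

theorem before_toWord (v : Ranking m) (x y : Fin m) :
    before (toWord v) (x : ℕ) (y : ℕ) = true ↔ v x < v y := by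
  simp [before, idxOf_toWord]

theorem countP_ofFn {k : ℕ} (P : ℕ → Bool) (g : Fin k → ℕ) :
    (List.ofFn g).countP P = ∑ i, (P (g i)).toNat := by
  induction k with
  | zero => simp
  | succ k ih =>
    rw [List.ofFn_succ, List.countP_cons, ih, Fin.sum_univ_succ, add_comm]
    cases P (g 0) <;> simp

theorem stepCost_singleton (v w : List ℕ) (x : ℕ) :
    stepCost [v] w x = w.countP fun y => before v y x := by simp [stepCost]

theorem listCost_ofFn {k : ℕ} (v : List ℕ) (g : Fin k → ℕ) :
    listCost [v] (List.ofFn g) = ∑ i, ∑ j, if i < j then (before v (g j) (g i)).toNat else 0 := by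
  induction k with
  | zero => simp [listCost]
  | succ k ih =>
    rw [List.ofFn_succ, listCost, ih, Fin.sum_univ_succ, stepCost_singleton, countP_ofFn]
    congr 1
    · rw [Fin.sum_univ_succ]; simp
    · refine Finset.sum_congr rfl fun i _ => ?_
      rw [Fin.sum_univ_succ]; simp

/-- The list cost is a sum over pairs of positions i < j; reindexing both sums by `π.symm` turns it
into the count over pairs of candidates. -/
theorem listCost_toWord (π v : Ranking m) : listCost [toWord v] (toWord π) = ktDist π v := by
  rw [toWord, toWord, listCost_ofFn, ktDist, Finset.card_filter, Fintype.sum_prod_type]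
  refine Eq.trans (Finset.sum_congr rfl fun i _ => ?_) (Equiv.sum_comp π.symm _)
  refine Eq.trans (Finset.sum_congr rfl fun j _ => ?_) (Equiv.sum_comp π.symm _)
  have := before_toWord v (π.symm j) (π.symm i)
  rw [toWord] at this
  simp only [Equiv.apply_symm_apply]
  by_cases h : i < j <;> by_cases h' : v (π.symm j) < v (π.symm i) <;> simp_all

theorem stepCost_eq_sum (V : List (List ℕ)) (w : List ℕ) (x : ℕ) :
    stepCost V w x = (V.map fun v => stepCost [v] w x).sum := by simp [stepCost]

theorem prefCost_eq_sum (V : List (List ℕ)) (p R : List ℕ) :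
    prefCost V p R = (V.map fun v => prefCost [v] p R).sum := by
  induction p with
  | nil => simp [prefCost]
  | cons x p ih =>
    simp only [prefCost]
    rw [List.sum_map_add, ih, stepCost_eq_sum]

theorem listCost_map_toWord (V : List (Ranking m)) (π : Ranking m) :
    listCost (V.map toWord) (toWord π) = score V π := by
  rw [listCost_eq, prefCost_eq_sum, List.map_map, score]
  congr 1
  refine List.map_congr_left fun v _ => ?_
  rw [← listCost_toWord, listCost_eq]
  rfl

theorem unanimous_map_toWord (V : List (Ranking m)) (x y : Fin m) :
    unanimous (V.map toWord) (x : ℕ) (y : ℕ) = true ↔ ∀ v ∈ V, v x < v y := by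
  simp [unanimous, before_toWord]

theorem prefAllowed_toWord {V : List (Ranking m)} (hV : V ≠ []) (π : Ranking m) :
    prefAllowed (V.map toWord) (toWord π) [] ↔ RespectsUnanimity V π := by
  rw [prefAllowed_iff_pairwise]
  conv_lhs => rw [toWord]
  rw [List.pairwise_ofFn]
  constructor
  · intro h x y hxy
    by_contra hlt
    -- With no votes every candidate would vacuously be preferred to itself; the case of equality
    -- therefore needs an actual vote.
    rcases (not_lt.1 hlt).eq_or_lt with he | hlt
    · obtain rfl : y = x := π.injective he
      obtain ⟨v, hv⟩ := List.exists_mem_of_ne_nil V hV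
      exact lt_irrefl _ (hxy v hv)
    · have := h hlt
      simp only [Equiv.symm_apply_apply] at this
      rw [(unanimous_map_toWord V x y).2 hxy] at this
      cases this
  · intro h i j hij
    rw [← Bool.not_eq_true]
    intro hu
    have := h _ _ ((unanimous_map_toWord V _ _).1 hu)
    simp only [Equiv.apply_symm_apply] at this
    exact lt_asymm hij this

/-- The context of an instance. -/
def Instance.ctx (I : Instance) : Ctx := (I.votes.map toWord, I.lam.num.toNat, I.lam.den, I.r)

theorem Instance.cands_ctx (I : Instance) : I.ctx.cands = toWord (I.votes.head I.votes_ne) := by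
  obtain ⟨m, votes, h, _, _, _⟩ := I
  cases votes with
  | nil => exact absurd rfl h
  | cons v V => rfl

theorem Instance.num_eq (I : Instance) : (I.lam.num.toNat : ℚ) = I.lam * I.lam.den := by
  have h0 : 0 ≤ I.lam.num := Rat.num_nonneg.2 (zero_le_one.trans I.one_le_lam)
  have h : ((I.lam.num.toNat : ℤ) : ℚ) = I.lam.num := by rw [Int.toNat_of_nonneg h0]
  rw [Rat.mul_den_eq_num, ← h]
  rfl

theorem Instance.good_ctx (I : Instance) : I.ctx.Good where
  ne := by simpa [ctx] using I.votes_ne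
  nodup := I.cands_ctx ▸ nodup_toWord _
  perm v hv := by
    obtain ⟨π, -, rfl⟩ := List.mem_map.1 hv
    exact I.cands_ctx ▸ toWord_perm _ _
  le := by
    change I.lam.den ≤ I.lam.num.toNat
    have h := I.num_eq
    have h1 : (0 : ℚ) < I.lam.den := by exact_mod_cast I.lam.den_pos
    have : (I.lam.den : ℚ) ≤ I.lam.num.toNat := by
      rw [h]; nlinarith [I.one_le_lam]
    exact_mod_cast this

theorem Instance.adm_toWord (I : Instance) (π : Ranking I.m) :
    I.ctx.Adm (toWord π) ↔ π ∈ I.admissible := by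
  have hp : ∀ σ : Ranking I.m, (toWord σ).Perm I.ctx.cands := fun σ => I.cands_ctx ▸ toWord_perm _ _
  have hd : (0 : ℚ) < I.lam.den := by exact_mod_cast I.lam.den_pos
  have hle : ∀ a b : ℕ, I.lam.den * a ≤ I.lam.num.toNat * b ↔ (a : ℚ) ≤ I.lam * b := fun a b => by
    rw [← @Nat.cast_le ℚ, Nat.cast_mul, Nat.cast_mul, I.num_eq, mul_comm I.lam, mul_assoc]
    exact mul_le_mul_iff_right₀ hd
  constructor
  · rintro ⟨-, h1, h2⟩
    refine ⟨(prefAllowed_toWord I.votes_ne _).1 h1, ?_⟩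
    obtain ⟨σ, -, hσ⟩ := Finset.exists_mem_eq_inf' Finset.univ_nonempty (score I.votes)
    rw [optScore, hσ, ← hle, ← listCost_map_toWord, ← listCost_map_toWord]
    exact h2 _ (hp σ)
  · rintro ⟨h1, h2⟩
    refine ⟨hp π, (prefAllowed_toWord I.votes_ne _).2 h1, fun u' hu' => ?_⟩
    rw [I.cands_ctx] at hu'
    obtain ⟨σ, rfl⟩ := exists_toWord hu'
    change I.lam.den * listCost (I.votes.map toWord) _ ≤
      I.lam.num.toNat * listCost (I.votes.map toWord) _
    rw [listCost_map_toWord, listCost_map_toWord, hle]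
    refine h2.trans (mul_le_mul_of_nonneg_left ?_ (zero_le_one.trans I.one_le_lam))
    exact_mod_cast Finset.inf'_le _ (Finset.mem_univ σ)

theorem Instance.exists_solution (I : Instance) :
    ∃ out : List (Ranking I.m), I.IsSolution out ∧ out.map toWord = solve I.ctx := by
  obtain ⟨h1, h2, h3, h4⟩ := solve_spec I.good_ctx
  obtain ⟨out, hout⟩ : ∃ out : List (Ranking I.m), out.map toWord = solve I.ctx := by
    have : ∀ L : List (List ℕ), (∀ u ∈ L, I.ctx.Adm u) →
        ∃ out : List (Ranking I.m), out.map toWord = L := fun L => by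
      induction L with
      | nil => exact fun _ => ⟨[], rfl⟩
      | cons u L ih =>
        intro h
        obtain ⟨out, ho⟩ := ih fun w hw => h w (by simp [hw])
        obtain ⟨π, hπ⟩ := exists_toWord (I.cands_ctx ▸ (h u (by simp)).1)
        exact ⟨π :: out, by simp [ho, hπ]⟩
    exact this _ h2
  refine ⟨out, ?_, hout⟩
  rw [← hout] at h1 h2 h3 h4
  have hn : out.Nodup := h1.of_map
  have hm : ∀ π ∈ out, π ∈ I.admissible := fun π hπ =>
    (I.adm_toWord π).1 (h2 _ (List.mem_map_of_mem hπ))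
  rw [List.length_map] at h3 h4
  have hcard : (out.toFinset : Set (Ranking I.m)).ncard = out.length := by
    rw [Set.ncard_coe_finset, List.toFinset_card_of_nodup hn]
  have hle : out.length ≤ I.admissible.ncard := hcard ▸
    Set.ncard_le_ncard (fun π hπ => hm π (by simpa using hπ)) (Set.toFinite _)
  refine ⟨hn, hm, ?_⟩
  rcases h4 with h | h
  · change out.length = I.r at h
    omega
  · change out.length ≤ I.r at h3
    have : I.admissible.ncard ≤ out.length := hcard ▸
      Set.ncard_le_ncard (fun π hπ => by
        obtain ⟨σ, hσ, he⟩ := List.mem_map.1 (h _ ((I.adm_toWord π).2 hπ))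
        rw [← toWord_injective he]
        simpa using hσ) (Set.toFinite _)
    omega

end Kemeny

namespace Kemeny
open Enc

/-! ### The number of states -/

/-- Number of pairs of a `true` and a later `false`. -/
def bitInv : List Bool → ℕ
  | [] => 0
  | b :: l => (if b then l.count false else 0) + bitInv l

/-- All bit lists of a given length. -/
def bitLists : ℕ → List (List Bool)
  | 0 => [[]]
  | n + 1 => (bitLists n).map (List.cons true) ++ (bitLists n).map (List.cons false)

/-- Number of bit lists of length `n` with at most `K` inversions. -/
def bitCount (n K : ℕ) : ℕ := ((bitLists n).filter fun l => decide (bitInv l ≤ K)).length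

theorem mem_bitLists {n : ℕ} {l : List Bool} : l ∈ bitLists n ↔ l.length = n := by
  induction n generalizing l with
  | zero => simp [bitLists]
  | succ n ih =>
    cases l with
    | nil => simp [bitLists]
    | cons b l => cases b <;> simp [bitLists, ih]

theorem before_cons {v : List ℕ} {a y x : ℕ} (hy : y ≠ a) (hx : x ≠ a) :
    before (a :: v) y x = before v y x := by
  simp [before, List.idxOf_cons_ne _ hy.symm, List.idxOf_cons_ne _ hx.symm]

/-- Inversions are grouped by their `false` member, matching the way in which `stepCost` charges a
placed candidate. -/
theorem bitInv_map (v : List ℕ) (hv : v.Nodup) (b : ℕ → Bool) :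
    bitInv (v.map b) =
      ((v.filter fun x => !b x).map fun x => v.countP fun y => b y && before v y x).sum := by
  induction v with
  | nil => simp [bitInv]
  | cons a v ih =>
    obtain ⟨ha, hv⟩ := List.nodup_cons.1 hv
    have hne : ∀ y ∈ v, y ≠ a := fun y hy h => ha (h ▸ hy)
    have e1 : ∀ x ∈ v, (v.countP fun y => b y && before (a :: v) y x) =
        v.countP fun y => b y && before v y x := fun x hx =>
      List.countP_congr fun y hy => by rw [before_cons (hne y hy) (hne x hx)]
    rw [List.map_cons, bitInv, ih hv]
    cases h : b a
    · have e2 : ((a :: v).countP fun y => b y && before (a :: v) y a) = 0 := by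
        rw [List.countP_eq_zero]
        intro y _
        simp [before]
      rw [List.filter_cons_of_pos (by simp [h]), List.map_cons, List.sum_cons, e2]
      simp only [Bool.false_eq_true, if_false]
      congr 2
      refine List.map_congr_left fun x hx => ?_
      rw [List.countP_cons_of_neg (by simp [h]), e1 x (List.mem_of_mem_filter hx)]
    · rw [List.filter_cons_of_neg (by simp [h])]
      have e3 : ((v.filter fun x => !b x).map fun x =>
          (a :: v).countP fun y => b y && before (a :: v) y x) =
          (v.filter fun x => !b x).map fun x => 1 + v.countP fun y => b y && before v y x := by
        refine List.map_congr_left fun x hx => ?_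
        have hx := List.mem_of_mem_filter hx
        rw [List.countP_cons_of_pos, e1 x hx, add_comm]
        simp [h, before, List.idxOf_cons_ne _ (hne x hx).symm]
      rw [e3, List.sum_map_add]
      congr 1
      simp only [if_true, List.map_const', List.sum_replicate, smul_eq_mul, mul_one]
      rw [List.count_eq_countP, List.countP_map, List.countP_eq_length_filter]
      congr 1
      exact List.filter_congr fun x _ => by simp

theorem stepCost_le_of_sublist {V : List (List ℕ)} {w w' : List ℕ} (h : w.Sublist w') (x : ℕ) :
    stepCost V w x ≤ stepCost V w' x :=
  List.sum_le_sum fun _ _ => h.countP_le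

/-- Disagreements among the placed candidates are discarded; those between placed and remaining
candidates suffice for the count. -/
theorem sum_stepCost_le_prefCost (V : List (List ℕ)) (p R : List ℕ) :
    (p.map (stepCost V R)).sum ≤ prefCost V p R := by
  induction p with
  | nil => simp [prefCost]
  | cons x p ih =>
    simp only [List.map_cons, List.sum_cons, prefCost]
    exact Nat.add_le_add (stepCost_le_of_sublist (List.sublist_append_right _ _) x) ih

/-- If `v` has a remaining candidate before a placed one, then every list starting with `p`
disagrees with `v` on this pair, and the cost of `p` includes it. -/
theorem bitInv_le_prefCost {v p R : List ℕ} (hv : v.Nodup) (h : (p ++ R).Perm v) :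
    bitInv (v.map fun y => decide (y ∈ R)) ≤ prefCost [v] p R := by
  have hnd : (p ++ R).Nodup := h.nodup_iff.2 hv
  obtain ⟨hp, hR, hd⟩ := List.nodup_append.1 hnd
  have h1 : (v.filter fun x => !decide (x ∈ R)).Perm p :=
    (List.perm_ext_iff_of_nodup (hv.filter _) hp).2 fun x => by
      rw [List.mem_filter, ← h.mem_iff, List.mem_append]
      simp only [Bool.not_eq_true', decide_eq_false_iff_not]
      exact ⟨fun h => h.1.resolve_right h.2, fun h => ⟨.inl h, fun h' => hd x h x h' rfl⟩⟩
  have h2 : (v.filter fun x => decide (x ∈ R)).Perm R :=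
    (List.perm_ext_iff_of_nodup (hv.filter _) hR).2 fun x => by
      rw [List.mem_filter, ← h.mem_iff, List.mem_append]
      simp only [decide_eq_true_iff]
      exact ⟨fun h => h.2, fun h => ⟨.inr h, h⟩⟩
  refine le_trans ?_ (sum_stepCost_le_prefCost [v] p R)
  rw [bitInv_map v hv, (h1.map _).sum_eq]
  refine List.sum_le_sum fun x _ => ?_
  rw [stepCost_singleton, ← h2.countP_eq, List.countP_filter]
  exact le_of_eq (List.countP_congr fun y _ => by simp [and_comm])

/-- Two averages are combined: over the votes that prune, bounding the cost of the state by a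
multiple of the average score, and over the votes that are marked, one of which has at most the
average number of inversions. The hypothesis `hK` is the resulting inequality cleared of
denominators. -/
theorem IsState.exists_bitInv_le {c : Ctx} (hc : c.Good) {free : Bool} {q : List ℕ × ℕ}
    (hq : IsState c free q) {K : ℕ}
    (hK : ∀ b, c.1.length * c.1.length * c.2.2.1 * b ≤ c.2.1 * (c.1.map (listCost c.1)).sum → b ≤ K) :
    ∃ v ∈ c.1, bitInv (v.map fun y => decide (y ∈ q.1)) ≤ K := by
  obtain ⟨p, h1, -, -, h4, h5⟩ := hq
  have hsum : (c.1.map fun v => bitInv (v.map fun y => decide (y ∈ q.1))).sum ≤ q.2 := by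
    rw [h4, prefCost_eq_sum]
    exact List.sum_le_sum fun v hv =>
      bitInv_le_prefCost ((hc.perm v hv).nodup_iff.2 hc.nodup) (h1.trans (hc.perm v hv).symm)
  obtain ⟨v, hv, hle⟩ := List.exists_le_of_sum_le hc.ne
    (fun v : List ℕ => c.1.length * bitInv (v.map fun y => decide (y ∈ q.1))) (fun _ => q.2) (by
      simpa [List.sum_map_mul_left] using Nat.mul_le_mul_left c.1.length hsum)
  refine ⟨v, hv, hK _ ?_⟩
  have hw : (c.1.map fun _ => c.2.2.1 * q.2).sum ≤ (c.1.map fun v => c.2.1 * listCost c.1 v).sum :=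
    List.sum_le_sum fun v hv => within_iff.1 h5 v hv
  rw [List.sum_map_mul_left, List.sum_map_mul_left] at hw
  simp only [List.map_const', List.sum_replicate, smul_eq_mul] at hw
  refine le_trans ?_ hw
  calc c.1.length * c.1.length * c.2.2.1 * bitInv (v.map fun y => decide (y ∈ q.1))
      = c.2.2.1 * (c.1.length * (c.1.length * bitInv (v.map fun y => decide (y ∈ q.1)))) := by ring
    _ ≤ c.2.2.1 * (c.1.length * q.2) := Nat.mul_le_mul_left _ (Nat.mul_le_mul_left _ hle)

theorem nodup_tableRun (c : Ctx) (free : Bool) (l : List ℕ) : (tableRun c free l).Nodup := by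
  induction l using List.reverseRecOn with
  | nil => simp [tableRun]
  | append_singleton l e _ => rw [tableRun_append]; exact nodup_dedupe _

/-- The remaining candidates, given a vote and the bit list that marks them. -/
def decodeBits (C v : List ℕ) (l : List Bool) : List ℕ :=
  C.filter fun y => (l[v.idxOf y]?).getD false

theorem decodeBits_map {C v R p : List ℕ} (h : v.Perm C) (hR : R = C.filter fun y => decide (y ∉ p)) :
    decodeBits C v (v.map fun y => decide (y ∈ R)) = R := by
  conv_rhs => rw [hR]
  refine List.filter_congr fun y hy => ?_
  have hlt : v.idxOf y < v.length := List.idxOf_lt_length_iff.2 (h.symm.subset hy)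
  rw [List.getElem?_map, List.getElem?_eq_getElem hlt]
  simp [hR, hy]

theorem IsState.snd_le {c : Ctx} {free : Bool} {q : List ℕ × ℕ}
    (hq : IsState c free q) : q.2 ≤ c.1.length * c.cands.length * c.cands.length := by
  obtain ⟨p, h1, -, -, h4, -⟩ := hq
  have := listCost_le c.1 (p ++ q.1)
  rw [listCost_append, h1.length_eq] at this
  omega

/-- A state is recovered from a vote with few inversions, the bit word of the remaining candidates
in that vote, and the cost; the table has no repetitions. -/
theorem length_tableRun_le {c : Ctx} (hc : c.Good) (free : Bool) (l : List ℕ) {K : ℕ}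
    (hK : ∀ b, c.1.length * c.1.length * c.2.2.1 * b ≤ c.2.1 * (c.1.map (listCost c.1)).sum → b ≤ K) :
    (tableRun c free l).length ≤ c.1.length * (bitCount c.cands.length K *
      (c.1.length * c.cands.length * c.cands.length + 1)) := by
  set M := c.1.length * c.cands.length * c.cands.length + 1
  set F := (bitLists c.cands.length).filter fun l => decide (bitInv l ≤ K)
  have hs : tableRun c free l ⊆ (c.1 ×ˢ (F ×ˢ List.range M)).map
      fun t => (decodeBits c.cands t.1 t.2.1, t.2.2) := fun q hq => by
    have hst := isState_of_mem_tableRun hc free l q hq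
    obtain ⟨v, hv, hle⟩ := hst.exists_bitInv_le hc hK
    have hsnd := hst.snd_le
    obtain ⟨p, -, h2, -⟩ := hst
    refine List.mem_map.2 ⟨(v, v.map fun y => decide (y ∈ q.1), q.2), ?_, ?_⟩
    · refine List.pair_mem_product.2 ⟨hv, List.pair_mem_product.2 ⟨List.mem_filter.2
        ⟨mem_bitLists.2 ?_, by simpa using hle⟩, List.mem_range.2 (by omega)⟩⟩
      rw [List.length_map, (hc.perm v hv).length_eq]
    · exact Prod.ext (decodeBits_map (hc.perm v hv) h2) rfl
  have := (List.subperm_of_subset (nodup_tableRun c free l) hs).length_le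
  simpa [List.length_product, bitCount, F] using this

theorem esize_tableRun_le {c : Ctx} (hc : c.Good) (free : Bool) (l : List ℕ) {K : ℕ}
    (hK : ∀ b, c.1.length * c.1.length * c.2.2.1 * b ≤ c.2.1 * (c.1.map (listCost c.1)).sum → b ≤ K) :
    esize (tableRun c free l) ≤ c.1.length * (bitCount c.cands.length K *
      (c.1.length * c.cands.length * c.cands.length + 1)) *
      (esize c.cands + (4 * (c.1.length * c.cands.length * c.cands.length) + 1) + 1 + 1) + 1 := by
  refine (esize_list_le _ _ fun q hq => ?_).trans
    (Nat.add_le_add_right (Nat.mul_le_mul_right _ (length_tableRun_le hc free l hK)) 1)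
  have hst := isState_of_mem_tableRun hc free l q hq
  have h1 := hst.snd_le
  have h2 := esize_nat_le q.2
  obtain ⟨p, -, h3, -⟩ := hst
  have h4 : esize q.1 ≤ esize c.cands := h3 ▸ esize_sublist List.filter_sublist
  rw [esize_mk]; omega

theorem esize_growRun_le {c : Ctx} (hc : c.Good) (l : List ℕ) (hl : l <+: c.cands) :
    esize (growRun c (table c true) (table c false) l) ≤
      (solve c).length * (esize c.cands * (esize c.cands + 1) + 1 + 1) + 1 := by
  have hlen : (growRun c (table c true) (table c false) l).length ≤ (solve c).length := by
    obtain ⟨l', h⟩ := hl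
    have := length_growRun_le hc l l' (by rw [h])
    rwa [h] at this
  refine (esize_list_le _ _ fun w hw => ?_).trans
    (Nat.add_le_add_right (Nat.mul_le_mul_right _ hlen) 1)
  have hE := ((isPartial_growRun hc l hl.length_le).2.1 w hw).2
  have h1 : w.length ≤ c.cands.length := (List.subperm_of_subset (hE.nodup hc) hE.subset).length_le
  refine (esize_list_le _ _ fun a ha => esize_le_of_mem (hE.subset ha)).trans ?_
  exact Nat.add_le_add_right (Nat.mul_le_mul_right _ (h1.trans (length_le_esize _))) 1

/-! ### The number of bit lists with few inversions -/

/-- Upper bound for the `q`-binomial coefficients. -/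
noncomputable def expBound (x : ℝ) (b : ℕ) : ℝ := Real.exp ((1 - x ^ (b + 1)) / (1 - x) ^ 2)

/-- The exponent is the sum of x^i/(1-x) over i ≤ b. With y = x^(b+1) ≤ x the claim becomes 1/(1-y)
≤ exp(y/(1-x)), which follows from 1/(1-y) = 1 + y/(1-y) ≤ exp(y/(1-y)). -/
theorem expBound_step {x : ℝ} (h0 : 0 < x) (h1 : x < 1) (b : ℕ) :
    x ^ (b + 1) * expBound x (b + 1) + expBound x b ≤ expBound x (b + 1) := by
  set y := x ^ (b + 1) with hy
  have hy0 : 0 < y := by positivity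
  have hyx : y ≤ x := pow_le_of_le_one h0.le h1.le (by omega)
  have hx : 0 < 1 - x := by linarith
  have hy1 : 0 < 1 - y := by linarith
  have e : expBound x b = expBound x (b + 1) * Real.exp (-(y / (1 - x))) := by
    rw [expBound, expBound, ← Real.exp_add]
    congr 1
    rw [pow_succ x (b + 1), ← hy]
    field_simp
    ring
  have h2 : Real.exp (-(y / (1 - x))) ≤ 1 - y := by
    rw [Real.exp_neg]
    have h3 : (1 - y)⁻¹ ≤ Real.exp (y / (1 - x)) := by
      have h4 := Real.add_one_le_exp (y / (1 - y))
      have h5 : y / (1 - y) ≤ y / (1 - x) := div_le_div_of_nonneg_left hy0.le hx (by linarith)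
      have h6 : (1 - y)⁻¹ = y / (1 - y) + 1 := by field_simp; ring
      rw [h6]
      exact h4.trans (Real.exp_le_exp.2 h5)
    exact inv_le_of_inv_le₀ hy1 h3
  have h7 : 0 < expBound x (b + 1) := Real.exp_pos _
  rw [e]
  nlinarith [mul_le_mul_of_nonneg_left h2 h7.le]

theorem one_le_expBound {x : ℝ} (h0 : 0 < x) (h1 : x < 1) (b : ℕ) : 1 ≤ expBound x b :=
  Real.one_le_exp (div_nonneg (sub_nonneg.2 (pow_le_one₀ h0.le h1.le)) (sq_nonneg _))

/-- The sum is a Gaussian binomial coefficient at x. Splitting by the first bit gives the q-Pascal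
recursion, and `expBound_step` says that the bound, which is independent of n, is compatible with
it. -/
theorem sum_bitLists_le {x : ℝ} (h0 : 0 < x) (h1 : x < 1) (n b : ℕ) :
    ((bitLists n).map fun l => if l.count false = b then x ^ bitInv l else 0).sum ≤ expBound x b := by
  induction n generalizing b with
  | zero =>
    refine le_trans ?_ (one_le_expBound h0 h1 b)
    simp only [bitLists, List.map_cons, List.map_nil, List.sum_cons, List.sum_nil, bitInv]
    split <;> simp
  | succ n ih =>
    have e1 : (((bitLists n).map (List.cons true)).map
        fun l => if l.count false = b then x ^ bitInv l else 0).sum =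
        x ^ b * ((bitLists n).map fun l => if l.count false = b then x ^ bitInv l else 0).sum := by
      rw [List.map_map, ← List.sum_map_mul_left]
      congr 1
      refine List.map_congr_left fun l _ => ?_
      simp only [Function.comp, bitInv, if_true, List.count_cons]
      by_cases h : l.count false = b <;> simp [h, pow_add]
    rw [bitLists, List.map_append, List.sum_append, e1]
    cases b with
    | zero =>
      have e2 : (((bitLists n).map (List.cons false)).map
          fun l => if l.count false = 0 then x ^ bitInv l else 0).sum = 0 := by
        rw [List.map_map]
        exact List.sum_eq_zero fun a ha => by
          obtain ⟨l, -, rfl⟩ := List.mem_map.1 ha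
          simp
      rw [e2]
      simpa using ih 0
    | succ b =>
      have e2 : (((bitLists n).map (List.cons false)).map
          fun l => if l.count false = b + 1 then x ^ bitInv l else 0).sum =
          ((bitLists n).map fun l => if l.count false = b then x ^ bitInv l else 0).sum := by
        rw [List.map_map]
        congr 1
        exact List.map_congr_left fun l _ => by simp [bitInv]
      rw [e2]
      refine le_trans (add_le_add (mul_le_mul_of_nonneg_left (ih (b + 1)) (by positivity)) (ih b)) ?_
      exact expBound_step h0 h1 b

/-- Each counted word has weight x^inversions ≥ x^K. The total weight of all words is then split by
the number of `false` bits, which takes n + 1 values. -/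
theorem bitCount_le {x : ℝ} (h0 : 0 < x) (h1 : x < 1) (n K : ℕ) :
    (bitCount n K : ℝ) * x ^ K ≤ (n + 1) * Real.exp (1 / (1 - x) ^ 2) := by
  have a1 : ∀ L : List (List Bool), (((L.filter fun l => decide (bitInv l ≤ K)).length : ℕ) : ℝ) * x ^ K ≤
      (L.map fun l => x ^ bitInv l).sum := fun L => by
    induction L with
    | nil => simp
    | cons l L ih =>
      rw [List.map_cons, List.sum_cons]
      by_cases h : bitInv l ≤ K
      · rw [List.filter_cons_of_pos (by simpa using h), List.length_cons]
        push_cast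
        have := pow_le_pow_of_le_one h0.le h1.le h
        linarith
      · rw [List.filter_cons_of_neg (by simpa using h)]
        have : 0 < x ^ bitInv l := by positivity
        linarith
  have a2 : ∀ L : List (List Bool), (∀ l ∈ L, l.length = n) → (L.map fun l => x ^ bitInv l).sum =
      ∑ b ∈ Finset.range (n + 1), (L.map fun l => if l.count false = b then x ^ bitInv l else 0).sum :=
    fun L => by
    induction L with
    | nil => simp
    | cons l L ih =>
      intro h
      simp only [List.map_cons, List.sum_cons, Finset.sum_add_distrib]
      rw [ih fun w hw => h w (by simp [hw]), Finset.sum_ite_eq, if_pos]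
      have := h l (by simp)
      have : l.count false ≤ l.length := List.count_le_length
      simp; omega
  refine (a1 _).trans ?_
  rw [a2 _ fun l hl => mem_bitLists.1 hl]
  refine (Finset.sum_le_card_nsmul _ _ (Real.exp (1 / (1 - x) ^ 2)) fun b _ =>
    (sum_bitLists_le h0 h1 n b).trans ?_).trans (by simp)
  refine Real.exp_le_exp.2 (div_le_div_of_nonneg_right ?_ (sq_nonneg _))
  have : 0 < x ^ (b + 1) := by positivity
  linarith

end Kemeny

namespace Kemeny
open Enc

/-! ### Running time -/

theorem polynomial_eval_le (p : Polynomial ℕ) (z : ℕ) :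
    p.eval z ≤ p.eval 1 * (z + 1) ^ (p.natDegree + 1) := by
  rw [Polynomial.eval_eq_sum_range, Polynomial.eval_eq_sum_range, Finset.sum_mul]
  refine Finset.sum_le_sum fun i hi => ?_
  rw [one_pow, mul_one]
  refine Nat.mul_le_mul_left _ ((Nat.pow_le_pow_left (Nat.le_succ z) i).trans ?_)
  exact Nat.pow_le_pow_right (Nat.succ_pos z) (by have := Finset.mem_range.1 hi; omega)

/-- The number of bit lists with at most `K` inversions grows so slowly with `K` that all its powers
are of order `16 ^ K`. -/
theorem exists_bitCount_pow_le (k : ℕ) (hk : k ≠ 0) : ∃ C : ℕ, ∀ n K : ℕ,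
    ((bitCount n K : ℝ) + 1) ^ k ≤ 16 ^ K * (C * (n + 1) ^ k) := by
  -- With the k-th root of 1/16, the k-th power of `bitCount_le` contains exactly 16^(-K). The only
  -- property of 16 that matters is 16 > 1.
  set x : ℝ := (16 : ℝ)⁻¹ ^ ((k : ℝ)⁻¹) with hx
  have h0 : 0 < x := by positivity
  have hxk : x ^ k = (16 : ℝ)⁻¹ := Real.rpow_inv_natCast_pow (by positivity) hk
  have h1 : x < 1 := by
    by_contra h
    have := one_le_pow₀ (n := k) (not_lt.1 h)
    rw [hxk] at this
    norm_num at this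
  set E := Real.exp (1 / (1 - x) ^ 2) with hE
  have hE0 : 0 < E := Real.exp_pos _
  obtain ⟨C, hC⟩ := exists_nat_ge ((E + 1) ^ k)
  refine ⟨C, fun n K => ?_⟩
  have hb := bitCount_le h0 h1 n K
  have h2 : ((bitCount n K : ℝ) + 1) * x ^ K ≤ (E + 1) * (n + 1) := by
    have := pow_le_one₀ (n := K) h0.le h1.le
    have : (0 : ℝ) ≤ n := n.cast_nonneg
    nlinarith
  have h3 := pow_le_pow_left₀ (by positivity) h2 k
  rw [mul_pow, ← pow_mul, mul_comm K, pow_mul, hxk, mul_pow, inv_pow] at h3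
  have h4 : ((bitCount n K : ℝ) + 1) ^ k ≤ 16 ^ K * ((E + 1) ^ k * (n + 1) ^ k) := by
    rwa [← div_eq_mul_inv, div_le_iff₀' (by positivity)] at h3
  refine h4.trans (mul_le_mul_of_nonneg_left ?_ (by positivity))
  exact mul_le_mul_of_nonneg_right hC (by positivity)

/-- The inequality a + N + 1 ≤ (a + 1)(N + 1) separates the two variables, and the power of N + 1 is
absorbed into 16^K, whatever the degree of `p`. -/
theorem exists_polynomial_bitCount (p : Polynomial ℕ) : ∃ q : Polynomial ℕ, ∀ a n K : ℕ, n ≤ a →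
    ((p.eval (a + bitCount n K) : ℕ) : ℝ) ≤ 16 ^ K * ((q.eval a : ℕ) : ℝ) := by
  set k := p.natDegree + 1
  obtain ⟨C, hC⟩ := exists_bitCount_pow_le k (Nat.succ_ne_zero _)
  refine ⟨Polynomial.C (p.eval 1 * C) * (Polynomial.X + 1) ^ (k + k), fun a n K hn => ?_⟩
  have h1 : ((p.eval (a + bitCount n K) : ℕ) : ℝ) ≤
      ((p.eval 1 : ℕ) : ℝ) * ((a : ℝ) + bitCount n K + 1) ^ k := by
    exact_mod_cast polynomial_eval_le p (a + bitCount n K)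
  have h2 : ((a : ℝ) + bitCount n K + 1) ^ k ≤ ((a : ℝ) + 1) ^ k * ((bitCount n K : ℝ) + 1) ^ k := by
    rw [← mul_pow]
    have : (0 : ℝ) ≤ a * bitCount n K := by positivity
    exact pow_le_pow_left₀ (by positivity) (by linarith) k
  have h3 : ((n : ℝ) + 1) ^ k ≤ ((a : ℝ) + 1) ^ k := by gcongr
  have h4 := hC n K
  calc ((p.eval (a + bitCount n K) : ℕ) : ℝ)
      ≤ ((p.eval 1 : ℕ) : ℝ) * (((a : ℝ) + 1) ^ k * (16 ^ K * (C * ((a : ℝ) + 1) ^ k))) := by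
        refine h1.trans (mul_le_mul_of_nonneg_left (h2.trans ?_) (Nat.cast_nonneg _))
        refine mul_le_mul_of_nonneg_left (h4.trans ?_) (by positivity)
        gcongr
    _ = _ := by
        simp only [Polynomial.eval_mul, Polynomial.eval_C, Polynomial.eval_pow, Polynomial.eval_add,
          Polynomial.eval_X, Polynomial.eval_one]
        push_cast
        ring

theorem ktDist_self {m : ℕ} (π : Ranking m) : ktDist π π = 0 := by
  rw [ktDist, Finset.card_eq_zero, Finset.filter_eq_empty_iff]
  exact fun p _ h => lt_asymm h.1 h.2

/-! ### The inversion bound in terms of the average distance, and the total running time. -/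

namespace Instance
variable (I : Instance)

/-- The integral part of `lam * d`. -/
def bound : ℕ := ⌊I.lam * avgDist I.votes⌋₊

theorem avgDist_nonneg : 0 ≤ avgDist I.votes := by
  have h : (1 : ℚ) ≤ I.votes.length := by
    exact_mod_cast List.length_pos_iff.2 I.votes_ne
  exact div_nonneg (Nat.cast_nonneg _) (mul_nonneg (by linarith) (by linarith))

theorem bound_le : (I.bound : ℚ) ≤ I.lam * avgDist I.votes :=
  Nat.floor_le (mul_nonneg (zero_le_one.trans I.one_le_lam) I.avgDist_nonneg)

theorem sum_listCost : (I.ctx.1.map (listCost I.ctx.1)).sum =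
    (I.votes.map fun v => (I.votes.map fun w => ktDist v w).sum).sum := by
  change ((I.votes.map toWord).map (listCost (I.votes.map toWord))).sum = _
  rw [List.map_map]
  congr 1
  exact List.map_congr_left fun v _ => listCost_map_toWord _ _

/-- The double sum of distances is n(n-1)d, so the hypothesis gives b ≤ λd(n-1)/n; the factor
(n-1)/n is given away. -/
theorem le_bound (b : ℕ) (h : I.ctx.1.length * I.ctx.1.length * I.ctx.2.2.1 * b ≤
    I.ctx.2.1 * (I.ctx.1.map (listCost I.ctx.1)).sum) : b ≤ I.bound := by
  rw [I.sum_listCost] at h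
  simp only [ctx, List.length_map] at h
  have hn : 0 < I.votes.length := List.length_pos_iff.2 I.votes_ne
  have hd : (0 : ℚ) < I.lam.den := by exact_mod_cast I.lam.den_pos
  have hlam : (0 : ℚ) ≤ I.lam := zero_le_one.trans I.one_le_lam
  set S := (I.votes.map fun v => (I.votes.map fun w => ktDist v w).sum).sum with hS
  have h1 : ((I.votes.length : ℚ) * I.votes.length) * b ≤ I.lam * S := by
    have h2 : ((I.votes.length * I.votes.length * I.lam.den * b : ℕ) : ℚ) ≤
        ((I.lam.num.toNat * S : ℕ) : ℚ) := by exact_mod_cast h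
    push_cast at h2
    rw [I.num_eq] at h2
    refine le_of_mul_le_mul_right ?_ hd
    linarith
  refine Nat.le_floor ?_
  rcases Nat.lt_or_ge 1 I.votes.length with h2 | h2
  · have h3 : (1 : ℚ) < I.votes.length := by exact_mod_cast h2
    have h4 : (0 : ℚ) < (I.votes.length : ℚ) * ((I.votes.length : ℚ) - 1) :=
      mul_pos (by linarith) (by linarith)
    rw [avgDist, ← hS, ← mul_div_assoc, le_div_iff₀ h4]
    refine le_trans ?_ h1
    have : (0 : ℚ) ≤ (b : ℚ) * I.votes.length := by positivity
    linarith
  -- For a single vote the average is 0/0 = 0, and b = 0 follows because the vote has distance 0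
  -- from itself.
  · obtain ⟨v, hv⟩ := List.length_eq_one_iff.1 (le_antisymm h2 hn)
    have hS0 : S = 0 := by simp [hS, hv, ktDist_self]
    have hb : (b : ℚ) ≤ 0 := by
      rw [hS0, hv] at h1
      simpa using h1
    exact hb.trans (mul_nonneg hlam I.avgDist_nonneg)

theorem length_cands : I.ctx.cands.length = I.m := by rw [I.cands_ctx, length_toWord]

/-- The encoded data of an instance. -/
def tuple : ℕ × List (List ℕ) × ℕ × ℕ × ℕ × Unit :=
  (I.m, I.ctx.1, I.lam.num.toNat, I.lam.den, I.r, ())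

/-- A list of five trees is the same tree as a nested pair that ends in `nil`; the component of type
`Unit` supplies this `nil`. -/
theorem enc_tuple : enc I.tuple = I.encode := by
  have h := enc_map_toWord I.votes
  simp only [tuple, enc_pair, ctx, h]
  rfl

theorem esize_tuple : esize I.tuple = I.encode.size := congrArg Data.size I.enc_tuple

theorem esize_votes_le : esize I.ctx.1 ≤ I.encode.size := by
  rw [← esize_tuple, tuple, esize_pair, esize_pair]; omega

theorem esize_cands_le : esize I.ctx.cands ≤ I.encode.size := by
  refine le_trans (esize_le_of_mem (l := I.ctx.1) ?_) I.esize_votes_le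
  rw [I.cands_ctx]
  exact List.mem_map_of_mem (List.head_mem I.votes_ne)

theorem length_cands_le : I.ctx.cands.length ≤ I.encode.size :=
  (length_le_esize _).trans I.esize_cands_le

/-- The measure in which the algorithm is polynomial. -/
def measure : ℕ := I.encode.size + (solve I.ctx).length + bitCount I.m I.bound

end Instance

/-- Every table and every list of segments is polynomial in `Instance.measure`, in which the output
length and the number of bit words stand next to the input size. -/
theorem PT.solve_ctx : PT Instance.measure Instance.encode fun I => Kemeny.solve I.ctx := by
  have hsz : PB Instance.measure fun I => I.encode.size :=
    PB.id.mono fun I => by unfold Instance.measure; omega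
  have htup : PT Instance.measure Instance.encode Instance.tuple :=
    PT.of_enc_eq (PF.id.toPT hsz) fun I => I.enc_tuple.symm
  have hctx : PT Instance.measure Instance.encode Instance.ctx :=
    (htup.comp (f := fun t : ℕ × List (List ℕ) × ℕ × ℕ × ℕ × Unit =>
      (t.2.1, t.2.2.1, t.2.2.2.1, t.2.2.2.2.1)) ((PF.fst.comp PF.snd).pair
        ((PF.fst.comp (PF.snd.comp PF.snd)).pair
          ((PF.fst.comp (PF.snd.comp (PF.snd.comp PF.snd))).pair
            (PF.fst.comp (PF.snd.comp (PF.snd.comp (PF.snd.comp PF.snd)))))))).of_enc_eq fun _ => rfl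
  refine PT.solve (B := fun I => I.measure * (I.measure *
      (I.measure * I.measure * I.measure + 1)) *
      (I.measure + (4 * (I.measure * I.measure * I.measure) + 1) + 1 + 1) + 1 +
      (I.measure * (I.measure * (I.measure + 1) + 1 + 1) + 1)) hctx ?_ ?_ ?_
  · have c : ∀ n : ℕ, PB Instance.measure fun _ => n := PB.const
    have h3 := (PB.id.mul PB.id).mul (PB.id (sz := Instance.measure))
    exact (((PB.id.mul (PB.id.mul (h3.add (c 1)))).mul
      (((PB.id.add (((c 4).mul h3).add (c 1))).add (c 1)).add (c 1))).add (c 1)).add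
      ((PB.id.mul (((PB.id.mul (PB.id.add (c 1))).add (c 1)).add (c 1))).add (c 1))
  · intro I b l _
    have h1 : I.ctx.1.length ≤ I.measure :=
      ((length_le_esize _).trans I.esize_votes_le).trans (by unfold Instance.measure; omega)
    have h2 : I.ctx.cands.length ≤ I.measure :=
      I.length_cands_le.trans (by unfold Instance.measure; omega)
    have h3 : esize I.ctx.cands ≤ I.measure :=
      I.esize_cands_le.trans (by unfold Instance.measure; omega)
    have h4 : bitCount I.ctx.cands.length I.bound ≤ I.measure := by
      rw [I.length_cands]; unfold Instance.measure; omega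
    refine (esize_tableRun_le I.good_ctx b l I.le_bound).trans (le_trans ?_ (Nat.le_add_right _ _))
    gcongr
  · intro I l hl
    have h1 : (Kemeny.solve I.ctx).length ≤ I.measure := by unfold Instance.measure; omega
    have h3 : esize I.ctx.cands ≤ I.measure :=
      I.esize_cands_le.trans (by unfold Instance.measure; omega)
    refine (esize_growRun_le I.good_ctx l hl).trans (le_trans ?_ (Nat.le_add_left _ _))
    gcongr

end Kemeny

theorem mainTheorem6 :
    ∃ (P : Kemeny.Program) (p : Polynomial ℕ), ∀ I : Kemeny.Instance,
      ∃ (out : List (Kemeny.Ranking I.m)) (t : ℕ),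
        I.IsSolution out ∧
        P.Runs I.encode (Kemeny.Data.ofRankings out) t ∧
        (t : ℝ) ≤ (16 : ℝ) ^ ((I.lam * Kemeny.avgDist I.votes : ℚ) : ℝ) *
          ((p.eval (I.encode.size + out.length) : ℕ) : ℝ) := by
  obtain ⟨-, P, T, ⟨p, hp⟩, hP⟩ := Kemeny.PT.solve_ctx
  obtain ⟨q, hq⟩ := Kemeny.exists_polynomial_bitCount p
  refine ⟨P 0, q, fun I => ?_⟩
  obtain ⟨out, hout, hmap⟩ := I.exists_solution
  obtain ⟨s, t, hexec, hs, -, ht⟩ := hP I 0 (Function.update (fun _ => Kemeny.Data.nil) 0 I.encode)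
    (by rw [Function.update_self]; rfl)
  have hlen : (Kemeny.solve I.ctx).length = out.length := by rw [← hmap, List.length_map]
  refine ⟨out, t, hout, ⟨s, hexec, by
    rw [hs, ← Kemeny.enc_map_toWord, hmap]⟩, ?_⟩
  have h1 : (t : ℝ) ≤ ((p.eval I.measure : ℕ) : ℝ) := by exact_mod_cast ht.trans (hp I)
  rw [Kemeny.Instance.measure, hlen] at h1
  have hm : I.m ≤ I.encode.size + out.length :=
    (I.length_cands.ge.trans I.length_cands_le).trans (Nat.le_add_right _ _)
  refine (h1.trans (hq _ _ _ hm)).trans (mul_le_mul_of_nonneg_right ?_ (Nat.cast_nonneg _))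
  -- The counting argument has the integer part of λd as exponent, which is at most λd itself.
  rw [← Real.rpow_natCast]
  refine Real.rpow_le_rpow_of_exponent_le (by norm_num) ?_
  exact_mod_cast I.bound_le
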